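/- **Setting.** Let $\mathit{Var}$ be a finite set of quantum variables; each $q$ has a Hilbert space $\mathcal H_q=\ell^2(B_q)$ with orthonormal basis $\{|b\rangle : b\in B_q\}$ (for example $B_q=\{0,1\}$ or $B_q=\mathbb Z$; infinite $B_q$ is allowed) and a distinguished basis state $|0\rangle$. For a register $\bar q\subseteq\mathit{Var}$ put $\mathcal H_{\bar q}=\bigotimes_{q\in\bar q}\mathcal H_q$, and $\mathcal H=\mathcal H_{\mathit{Var}}$. Operators and superoperators on $\mathcal H_{\bar q}$ act on $\mathcal H$ as the identity on the other variables. $\sqsubseteq$ is the Löwner order, $\mathcal D(\mathcal K)$ the set of positive trace-class operators on $\mathcal K$ with trace at most $1$, and $\|A\|_1=\mathrm{tr}|A|$. A superoperator is a completely positive, trace-non-increasing linear map on the trace-class operators. **Programs.** Noisy programs are generated by $$\widetilde P ::= \mathbf{skip}\mid q:=|0\rangle\mid \bar q:\cong_{p,\Phi}U[\bar q]\mid \widetilde P_1;\widetilde P_2\mid \mathbf{if}\ M[\bar q]=\overline{m\to\widetilde P_m}\ \mathbf{fi}\mid \mathbf{while}\ M[\bar q]=1\ \mathbf{do}\ \widetilde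 P_1\ \mathbf{od},$$ where $U$ is unitary, $p\in[0,1]$ and $\Phi$ is a superoperator on $\mathcal H_{\bar q}$, and $M=\{M_m\}$ is a measurement with finitely many outcomes ($\sum_m M_m^\dagger M_m=I$; outcomes $0,1$ for loops). The ideal program $P=\mathtt{ideal}(\widetilde P)$ replaces each $\bar q:\cong_{p,\Phi}U[\bar q]$ by $\bar q:=U[\bar q]$. Denotations are: $[\![\mathbf{skip}]\!]\rho=\rho$; $[\![q:=|0\rangle]\!]\rho=\sum_{n\in B_q}|0\rangle_q\langle n|\rho|n\rangle_q\langle 0|$; $[\![\bar q:=U[\bar q]]\!]\rho=U\rho U^\dagger$; $[\![\bar q:\cong_{p,\Phi}U[\bar q]]\!]\rho=(1-p)U\rho U^\dagger+p\,\Phi(\rho)$; $[\![P_1;P_2]\!]=[\![P_2]\!]\circ[\![P_1]\!]$; for the case statement, $\rho\mapsto\sum_m[\![P_m]\!](M_m\rho M_m^\dagger)$; and for the loop, $\bigsqcup_k W_k$, the least upper bound (in the pointwise Löwner order on positive trace-class operators) of $W_0=0$, $W_{k+1}(\rho)=M_0\rho M_0^\dagger+W_k([\![P_1]\!](M_1\rho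 M_1^\dagger))$. **Robustness.** A quantum predicate is an operator $Q$ on $\mathcal H$ with $0\sqsubseteq Q\sqsubseteq I$. For superoperators $\mathcal E,\mathcal E'$ on $\mathcal H$ and $\lambda\in[0,1]$, $$\|\mathcal E-\mathcal E'\|_{Q,\lambda}=\sup\ \tfrac12\big\|(\mathcal E\otimes I_{\mathcal A})(\rho)-(\mathcal E'\otimes I_{\mathcal A})(\rho)\big\|_1$$ over all auxiliary spaces $\mathcal A=\ell^2(K)$, $K$ a set, and all $\rho\in\mathcal D(\mathcal H\otimes\mathcal A)$ with $\mathrm{tr}(\rho)=1$ and $\mathrm{tr}((Q\otimes I_{\mathcal A})\rho)\ge\lambda$ (the supremum of the empty set being $0$). For a predicate $Q$, $\lambda\in[0,1]$ and a real $\epsilon\ge0$, $\widetilde P$ is *$\epsilon$-robust under $(Q,\lambda)$* if $\|[\![\widetilde P]\!]-[\![P]\!]\|_{Q,\lambda}\le\epsilon$. The Hoare triple $\{Q\}P\{R\}$ means $\mathrm{tr}(Q\rho)\le\mathrm{tr}(R[\![P]\!]\rho)$ for all $\rho\in\mathcal D(\mathcal H)$. The loop $\mathbf{while}\ M[\bar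 q]=1\ \mathbf{do}\ P_1\ \mathbf{od}$ is *$(a,n)$-bounded* if $0\le a<1$, $n\ge1$ is an integer, and $(\mathcal E^*)^n(M_1^\dagger M_1)\sqsubseteq a\,M_1^\dagger M_1$, where $\mathcal E(\rho)=[\![P_1]\!](M_1\rho M_1^\dagger)$ and $\mathcal E^*$ is its dual, $\mathrm{tr}(A\,\mathcal E(\rho))=\mathrm{tr}(\mathcal E^*(A)\rho)$. **Rules.** Judgments $(Q,\lambda)\vdash\widetilde P\le\epsilon$ are derived by the following rules. In (Skip), (Init), (Unitary), (Weaken), (Rescale) and (While-Unbounded) the pair $(Q,\lambda)$ of the conclusion consists of a quantum predicate and a number in $[0,1]$. * (Skip), (Init): $(Q,\lambda)\vdash\mathbf{skip}\le0$ and $(Q,\lambda)\vdash(q:=|0\rangle)\le0$. * (Unitary): if $\epsilon\ge0$ and $\|U\circ U^\dagger-\Phi\|_{Q,\lambda}\le\epsilon$, then $(Q,\lambda)\vdash(\bar q:\cong_{p,\Phi}U[\bar q])\le p\epsilon$. * (Weaken): if $(Q',\lambda')\vdash\widetilde P\le\epsilon'$, $\epsilon'\le\epsilon$, $Q\sqsubseteq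 Q'$, $\lambda'\le\lambda$, then $(Q,\lambda)\vdash\widetilde P\le\epsilon$. * (Rescale): if $\delta>0$, $(Q/\delta,\lambda/\delta)\vdash\widetilde P\le\epsilon$, $0\sqsubseteq Q$, $Q/\delta\sqsubseteq I$ and $0\le\lambda,\lambda/\delta\le1$ (both $Q$ and $Q/\delta$ being predicates), then $(Q,\lambda)\vdash\widetilde P\le\epsilon$. * (Sequence): if $(Q_1,\lambda)\vdash\widetilde P_1\le\epsilon_1$, $(Q_2,\lambda)\vdash\widetilde P_2\le\epsilon_2$ and $\{Q_1\}P_1\{Q_2\}$, then $(Q_1,\lambda)\vdash(\widetilde P_1;\widetilde P_2)\le\epsilon_1+\epsilon_2$. * (Case): if $t,\delta\in[0,1]$ and $(Q_m,1-\delta)\vdash\widetilde P_m\le\epsilon$ for every $m$, then $(\sum_mM_m^\dagger Q_mM_m,\,1-t\delta)\vdash(\mathbf{if}\ M[\bar q]=\overline{m\to\widetilde P_m}\ \mathbf{fi})\le(1-t)\epsilon+t$. * (While-Bounded): if $(Q,\lambda)\vdash\widetilde P_1\le\epsilon$, $\{Q\}P_1\{\lambda M_0^\dagger M_0+M_1^\dagger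 QM_1\}$, and the ideal loop $\mathbf{while}\ M[\bar q]=1\ \mathbf{do}\ P_1\ \mathbf{od}$ is $(a,n)$-bounded, then $(\lambda M_0^\dagger M_0+M_1^\dagger QM_1,\,\lambda)\vdash(\mathbf{while}\ M[\bar q]=1\ \mathbf{do}\ \widetilde P_1\ \mathbf{od})\le n\epsilon/(1-a)$. * (While-Unbounded): $(Q,\lambda)\vdash(\mathbf{while}\ M[\bar q]=1\ \mathbf{do}\ \widetilde P_1\ \mathbf{od})\le1$. **Theorem (Soundness).** If $(Q,\lambda)\vdash\widetilde P\le\epsilon$ is derivable, then $\widetilde P$ is $\epsilon$-robust under $(Q,\lambda)$. -/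

import Mathlib

open scoped ENNReal InnerProductSpace

noncomputable section

namespace QRobust

/-! ## Hilbert spaces with a distinguished orthonormal basis -/

/-- The Hilbert space with orthonormal basis `|x⟩`, `x : X`, that is, `ℓ²(X)`. -/
def Ell2 (X : Type) : Type := lp (fun _ : X => ℂ) 2

instance (X : Type) : NormedAddCommGroup (Ell2 X) :=
  inferInstanceAs (NormedAddCommGroup (lp (fun _ : X => ℂ) 2))

instance (X : Type) : InnerProductSpace ℂ (Ell2 X) :=
  inferInstanceAs (InnerProductSpace ℂ (lp (fun _ : X => ℂ) 2))

instance (X : Type) : CompleteSpace (Ell2 X) :=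
  inferInstanceAs (CompleteSpace (lp (fun _ : X => ℂ) 2))

/-- The coordinates of a vector. -/
def Ell2.coord {X : Type} (f : Ell2 X) : X → ℂ := (show lp (fun _ : X => ℂ) 2 from f)

open Classical in
/-- The basis vector `|x⟩`. -/
def ket {X : Type} (x : X) : Ell2 X := (lp.single 2 x (1 : ℂ) : lp (fun _ : X => ℂ) 2)

/-- Bounded operators.  `A ≤ B` is the Löwner order, `star A` the adjoint. -/
abbrev Op (X : Type) : Type := Ell2 X →L[ℂ] Ell2 X

/-- The outer product `|x⟩⟨y|`. -/
def ketBra {X : Type} (x y : X) : Op X := InnerProductSpace.rankOne ℂ (ket x) (ket y)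

/-- The trace: the sum of the diagonal entries (used for trace-class operators only). -/
def tr {X : Type} (A : Op X) : ℂ := ∑' x, ⟪ket x, A (ket x)⟫_ℂ

/-- The trace norm `tr |A|`, where `|A| = (A† A)^{1/2}`.  For a Hermitian trace-class
operator it is the sum of the absolute values of the eigenvalues. -/
def traceNorm {X : Type} (A : Op X) : ℝ≥0∞ :=
  ∑' x, ENNReal.ofReal (⟪ket x, CFC.abs A (ket x)⟫_ℂ).re

/-- The trace distance `½ ‖A - B‖₁`. -/
def traceDist {X : Type} (A B : Op X) : ℝ≥0∞ := traceNorm (A - B) / 2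

/-- Trace-class operators: the linear span of the positive operators of finite trace. -/
def TC (X : Type) : Submodule ℂ (Op X) :=
  Submodule.span ℂ {ρ : Op X | 0 ≤ ρ ∧ Summable fun x => ⟪ket x, ρ (ket x)⟫_ℂ}

/-- Partial density operators: positive trace-class operators of trace at most one. -/
def IsPartialDensity {X : Type} (ρ : TC X) : Prop := 0 ≤ (ρ : Op X) ∧ (tr (ρ : Op X)).re ≤ 1

/-- Density operators: positive trace-class operators of trace one. -/
def IsDensity {X : Type} (ρ : TC X) : Prop := 0 ≤ (ρ : Op X) ∧ tr (ρ : Op X) = 1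

/-- Quantum predicates: `0 ⊑ Q ⊑ I`. -/
def IsPredicate {X : Type} (Q : Op X) : Prop := 0 ≤ Q ∧ Q ≤ 1

/-! ### Facts needed to see that `ρ ↦ V ρ W†` preserves the trace class -/

theorem Ell2.inner_eq {X : Type} (f g : Ell2 X) :
    ⟪f, g⟫_ℂ = ∑' x, ⟪f.coord x, g.coord x⟫_ℂ := rfl

theorem Ell2.summable_sq {X : Type} (f : Ell2 X) : Summable fun x => ‖f.coord x‖ ^ 2 := by
  have h := (lp.memℓp (show lp (fun _ : X => ℂ) 2 from f)).summable (by norm_num)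
  simpa [Ell2.coord] using h

theorem Ell2.norm_sq {X : Type} (f : Ell2 X) : ‖f‖ ^ 2 = ∑' x, ‖f.coord x‖ ^ 2 := by
  have h := lp.norm_rpow_eq_tsum (p := 2) (by norm_num) (show lp (fun _ : X => ℂ) 2 from f)
  have h2 : ‖f‖ = ‖(show lp (fun _ : X => ℂ) 2 from f)‖ := rfl
  rw [h2]
  simpa [Ell2.coord] using h

theorem Ell2.inner_ket {X : Type} (x : X) (f : Ell2 X) : ⟪ket x, f⟫_ℂ = f.coord x := by
  classical
  have h := lp.inner_single_left (𝕜 := ℂ) x (1 : ℂ) (show lp (fun _ : X => ℂ) 2 from f)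
  have h2 : ⟪ket x, f⟫_ℂ = ⟪(lp.single 2 x (1 : ℂ) : lp (fun _ : X => ℂ) 2),
    (show lp (fun _ : X => ℂ) 2 from f)⟫_ℂ := by
    unfold ket
    congr!
  rw [h2, h]
  simp [Ell2.coord]

theorem Ell2.ofReal_norm_sq {X : Type} (f : Ell2 X) :
    ENNReal.ofReal (‖f‖ ^ 2) = ∑' x, ENNReal.ofReal (‖⟪ket x, f⟫_ℂ‖ ^ 2) := by
  simp_rw [Ell2.inner_ket]
  rw [Ell2.norm_sq, ENNReal.ofReal_tsum_of_nonneg (fun _ => by positivity) f.summable_sq]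

/-- Build a vector from its coordinates. -/
def Ell2.mk {X : Type} (f : X → ℂ) (hf : Summable fun x => ‖f x‖ ^ 2) : Ell2 X :=
  (⟨f, memℓp_gen (by simpa using hf)⟩ : lp (fun _ : X => ℂ) 2)

theorem Ell2.coord_mk {X : Type} (f : X → ℂ) (hf : Summable fun x => ‖f x‖ ^ 2) :
    (Ell2.mk f hf).coord = f := rfl

theorem Ell2.ext {X : Type} {f g : Ell2 X} (h : ∀ x, f.coord x = g.coord x) : f = g :=
  lp.ext (E := fun _ : X => ℂ) (funext h)

theorem Ell2.coord_add {X : Type} (f g : Ell2 X) (x : X) :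
    (f + g).coord x = f.coord x + g.coord x := rfl

theorem Ell2.coord_smul {X : Type} (c : ℂ) (f : Ell2 X) (x : X) :
    (c • f).coord x = c * f.coord x := rfl

theorem sum_norm_adjoint {X Y : Type} (T : Ell2 X →L[ℂ] Ell2 Y) :
    ∑' y, ENNReal.ofReal (‖T.adjoint (ket y)‖ ^ 2) = ∑' x, ENNReal.ofReal (‖T (ket x)‖ ^ 2) := by
  simp_rw [Ell2.ofReal_norm_sq]
  rw [ENNReal.tsum_comm]
  refine tsum_congr fun x => tsum_congr fun y => ?_
  rw [ContinuousLinearMap.adjoint_inner_right, norm_inner_symm]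

theorem diag_eq {X Y : Type} {ρ : Op X} (hρ : 0 ≤ ρ) (V : Ell2 X →L[ℂ] Ell2 Y) (y : Y) :
    ⟪ket y, (V ∘L ρ ∘L V.adjoint) (ket y)⟫_ℂ
      = ((‖CFC.sqrt ρ (V.adjoint (ket y))‖ ^ 2 : ℝ) : ℂ) := by
  have hs : ContinuousLinearMap.adjoint (CFC.sqrt ρ) = CFC.sqrt ρ :=
    (CFC.sqrt_nonneg ρ).isSelfAdjoint.star_eq
  have h1 : ρ (V.adjoint (ket y)) = CFC.sqrt ρ (CFC.sqrt ρ (V.adjoint (ket y))) := by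
    conv_lhs => rw [← CFC.sqrt_mul_sqrt_self ρ hρ]
    rfl
  have h2 : ⟪ket y, (V ∘L ρ ∘L V.adjoint) (ket y)⟫_ℂ
      = ⟪V.adjoint (ket y), ρ (V.adjoint (ket y))⟫_ℂ := by
    rw [ContinuousLinearMap.adjoint_inner_left]
    rfl
  rw [h2, h1, ← ContinuousLinearMap.adjoint_inner_left, hs, inner_self_eq_norm_sq_to_K]
  push_cast
  rfl

theorem conj_summable {X Y : Type} {ρ : Op X} (hρ : 0 ≤ ρ)
    (hs : Summable fun x => ⟪ket x, ρ (ket x)⟫_ℂ) (V : Ell2 X →L[ℂ] Ell2 Y) :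
    Summable fun y => ⟪ket y, (V ∘L ρ ∘L V.adjoint) (ket y)⟫_ℂ := by
  have key : ∀ {Z : Type} (W : Ell2 X →L[ℂ] Ell2 Z),
      (∑' z, ENNReal.ofReal (‖CFC.sqrt ρ (W.adjoint (ket z))‖ ^ 2)) ≠ ∞ →
      Summable fun z => ‖CFC.sqrt ρ (W.adjoint (ket z))‖ ^ 2 := by
    intro Z W h
    have := ENNReal.summable_toReal h
    simpa [ENNReal.toReal_ofReal] using this
  have hadj : ContinuousLinearMap.adjoint (CFC.sqrt ρ) = CFC.sqrt ρ :=
    (CFC.sqrt_nonneg ρ).isSelfAdjoint.star_eq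
  have hbase : Summable fun x => ‖CFC.sqrt ρ (ket x)‖ ^ 2 := by
    have h := hs
    have h3 : ∀ x : X, ⟪ket x, ρ (ket x)⟫_ℂ = ((‖CFC.sqrt ρ (ket x)‖ ^ 2 : ℝ) : ℂ) := by
      intro x
      have := diag_eq hρ (ContinuousLinearMap.id ℂ (Ell2 X)) x
      rw [show ContinuousLinearMap.adjoint (ContinuousLinearMap.id ℂ (Ell2 X))
        = ContinuousLinearMap.id ℂ (Ell2 X) from star_one (Op X)] at this
      simpa using this
    simp_rw [h3] at h
    exact Complex.summable_ofReal.mp h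
  simp_rw [diag_eq hρ V]
  refine Complex.summable_ofReal.mpr (key V ?_)
  have h4 := sum_norm_adjoint (V ∘L CFC.sqrt ρ)
  rw [ContinuousLinearMap.adjoint_comp, hadj] at h4
  have h5 : ∑' x, ENNReal.ofReal (‖(V ∘L CFC.sqrt ρ) (ket x)‖ ^ 2)
      ≤ ∑' x, ENNReal.ofReal (‖V‖ ^ 2 * ‖CFC.sqrt ρ (ket x)‖ ^ 2) := by
    refine ENNReal.tsum_le_tsum fun x => ENNReal.ofReal_le_ofReal ?_
    rw [← mul_pow]
    exact pow_le_pow_left₀ (norm_nonneg _) (V.le_opNorm _) 2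
  have h6 : ∑' x, ENNReal.ofReal (‖V‖ ^ 2 * ‖CFC.sqrt ρ (ket x)‖ ^ 2) ≠ ∞ := by
    rw [← ENNReal.ofReal_tsum_of_nonneg (fun _ => by positivity) (hbase.mul_left _)]
    exact ENNReal.ofReal_ne_top
  rw [← h4] at h5
  exact ne_top_of_le_ne_top h6 h5

theorem conj_nonneg {X Y : Type} {ρ : Op X} (hρ : 0 ≤ ρ) (V : Ell2 X →L[ℂ] Ell2 Y) :
    (0 : Op Y) ≤ V ∘L ρ ∘L V.adjoint := by
  rw [ContinuousLinearMap.nonneg_iff_isPositive] at hρ ⊢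
  exact hρ.conj_adjoint V

theorem polarization {X Y : Type} (ρ : Op X) (V W : Ell2 X →L[ℂ] Ell2 Y) :
    V ∘L ρ ∘L W.adjoint = (1 / 4 : ℂ) •
      ((V + W) ∘L ρ ∘L (V + W).adjoint - (V - W) ∘L ρ ∘L (V - W).adjoint
        + Complex.I • ((V + Complex.I • W) ∘L ρ ∘L (V + Complex.I • W).adjoint)
        - Complex.I • ((V - Complex.I • W) ∘L ρ ∘L (V - Complex.I • W).adjoint)) := by
  simp only [map_add, map_sub, LinearIsometryEquiv.map_smulₛₗ, Complex.conj_I]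
  ext f
  simp only [ContinuousLinearMap.comp_apply, add_apply,
    sub_apply, smul_apply, map_add, map_sub, map_smul]
  match_scalars <;> (try ring_nf) <;> (try simp only [Complex.I_sq]) <;> ring_nf

theorem sandwich_mem {X Y : Type} (V W : Ell2 X →L[ℂ] Ell2 Y) {ρ : Op X} (hρ : ρ ∈ TC X) :
    V ∘L ρ ∘L W.adjoint ∈ TC Y := by
  induction hρ using Submodule.span_induction with
  | mem ρ h =>
    have hc : ∀ U : Ell2 X →L[ℂ] Ell2 Y, U ∘L ρ ∘L U.adjoint ∈ TC Y := fun U =>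
      Submodule.subset_span ⟨conj_nonneg h.1 U, conj_summable h.1 h.2 U⟩
    rw [polarization]
    exact Submodule.smul_mem _ _ (Submodule.sub_mem _ (Submodule.add_mem _ (Submodule.sub_mem _
      (hc _) (hc _)) (Submodule.smul_mem _ _ (hc _))) (Submodule.smul_mem _ _ (hc _)))
  | zero => simp
  | add A B _ _ hA hB =>
    have : V ∘L (A + B) ∘L W.adjoint = V ∘L A ∘L W.adjoint + V ∘L B ∘L W.adjoint := by
      ext f; simp
    rw [this]
    exact Submodule.add_mem _ hA hB
  | smul c A _ hA =>
    have : V ∘L (c • A) ∘L W.adjoint = c • (V ∘L A ∘L W.adjoint) := by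
      ext f; simp
    rw [this]
    exact Submodule.smul_mem _ _ hA

/-! ## Superoperators -/

/-- Linear maps on the trace class of `ℓ²(X)`. -/
abbrev SuperMap (X : Type) : Type := TC X →ₗ[ℂ] TC X

/-- The map `ρ ↦ V ρ W†`. -/
def sandwich {X Y : Type} (V W : Ell2 X →L[ℂ] Ell2 Y) : TC X →ₗ[ℂ] TC Y where
  toFun ρ := ⟨V ∘L (ρ : Op X) ∘L W.adjoint, sandwich_mem V W ρ.2⟩
  map_add' A B := by ext f; simp
  map_smul' c A := by ext f; simp

/-- The map `V ∘ V†`, that is, `ρ ↦ V ρ V†`. -/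
def conj {X : Type} (V : Op X) : SuperMap X := sandwich V V

/-- The unique linear map with the property `p` (`0` if there is no such map). -/
def theMap {X : Type} (p : SuperMap X → Prop) : SuperMap X :=
  open Classical in if h : ∃ F, p F then h.choose else 0

/-! ### Tensor products with an identity

A tensor product decomposition of `ℓ²(Z)` as `ℓ²(X) ⊗ ℓ²(K)` is given by a bijection
`e : X × K ≃ Z` of the bases, the basis vector `|x⟩ ⊗ |k⟩` being `|e (x, k)⟩`. -/

/-- The map `I ⊗ ⟨k|` from `ℓ²(X) ⊗ ℓ²(K)` to `ℓ²(X)`. -/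
def slice {X K Z : Type} (e : X × K ≃ Z) (k : K) : Ell2 Z →L[ℂ] Ell2 X :=
  LinearMap.mkContinuous
    { toFun := fun f => Ell2.mk (fun x => f.coord (e (x, k)))
        (f.summable_sq.comp_injective (i := fun x => e (x, k)) (fun x y h => by simpa using h))
      map_add' := fun _ _ => rfl
      map_smul' := fun _ _ => rfl } 1 (fun f => by
        rw [one_mul]
        refine (pow_le_pow_iff_left₀ (norm_nonneg _) (norm_nonneg _) two_ne_zero).1 ?_
        rw [Ell2.norm_sq, Ell2.norm_sq]
        exact Summable.tsum_le_tsum_of_inj (fun x => e (x, k)) (fun x y h => by simpa using h)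
          (fun _ _ => by positivity) (fun _ => le_rfl) (Ell2.summable_sq _) f.summable_sq)

theorem sum_slice {X K Z : Type} (e : X × K ≃ Z) (f : Ell2 Z) :
    ∑' k, ENNReal.ofReal (‖slice e k f‖ ^ 2) = ENNReal.ofReal (‖f‖ ^ 2) := by
  have h : ∀ {W : Type} (g : Ell2 W), ENNReal.ofReal (‖g‖ ^ 2)
      = ∑' w, ENNReal.ofReal (‖g.coord w‖ ^ 2) := fun g => by
    rw [Ell2.norm_sq, ENNReal.ofReal_tsum_of_nonneg (fun _ => by positivity) g.summable_sq]
  simp_rw [h]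
  rw [ENNReal.tsum_comm, ← e.tsum_eq, ENNReal.tsum_prod']
  rfl

theorem tensorOp_aux {X K Z : Type} (e : X × K ≃ Z) (A : Op X) (f : Ell2 Z) :
    ∑' z, ENNReal.ofReal (‖(A (slice e (e.symm z).2 f)).coord (e.symm z).1‖ ^ 2)
      ≤ ENNReal.ofReal ((‖A‖ * ‖f‖) ^ 2) := by
  rw [← e.tsum_eq, ENNReal.tsum_prod', ENNReal.tsum_comm]
  simp only [Equiv.symm_apply_apply]
  have h : ∀ g : Ell2 X, ENNReal.ofReal (‖g‖ ^ 2)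
      = ∑' w, ENNReal.ofReal (‖g.coord w‖ ^ 2) := fun g => by
    rw [Ell2.norm_sq, ENNReal.ofReal_tsum_of_nonneg (fun _ => by positivity) g.summable_sq]
  simp_rw [← h]
  rw [mul_pow, ENNReal.ofReal_mul (by positivity), ← sum_slice e f, ← ENNReal.tsum_mul_left]
  refine ENNReal.tsum_le_tsum fun k => ?_
  rw [← ENNReal.ofReal_mul (by positivity), ← mul_pow]
  exact ENNReal.ofReal_le_ofReal (pow_le_pow_left₀ (norm_nonneg _) (A.le_opNorm _) 2)

theorem tensorOp_summable {X K Z : Type} (e : X × K ≃ Z) (A : Op X) (f : Ell2 Z) :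
    Summable fun z => ‖(A (slice e (e.symm z).2 f)).coord (e.symm z).1‖ ^ 2 := by
  have := ENNReal.summable_toReal (ne_top_of_le_ne_top ENNReal.ofReal_ne_top (tensorOp_aux e A f))
  simpa [ENNReal.toReal_ofReal] using this

/-- The operator `A ⊗ I` on `ℓ²(X) ⊗ ℓ²(K)`. -/
def tensorOp {X K Z : Type} (e : X × K ≃ Z) (A : Op X) : Op Z :=
  LinearMap.mkContinuous
    { toFun := fun f => Ell2.mk (fun z => (A (slice e (e.symm z).2 f)).coord (e.symm z).1)
        (tensorOp_summable e A f)
      map_add' := fun f g => Ell2.ext fun z => by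
        simp only [Ell2.coord_add, Ell2.coord_mk, map_add]
      map_smul' := fun c f => Ell2.ext fun z => by
        simp only [Ell2.coord_smul, Ell2.coord_mk, map_smul, RingHom.id_apply] } ‖A‖ (fun f => by
        refine (pow_le_pow_iff_left₀ (norm_nonneg _) (by positivity) two_ne_zero).1 ?_
        rw [← ENNReal.ofReal_le_ofReal_iff (by positivity), Ell2.norm_sq,
          ENNReal.ofReal_tsum_of_nonneg (fun _ => by positivity) (Ell2.summable_sq _)]
        exact tensorOp_aux e A f)

/-- The block `(I ⊗ ⟨k|) T (I ⊗ |l⟩)` of an operator `T` on `ℓ²(X) ⊗ ℓ²(K)`. -/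
def block {X K Z : Type} (e : X × K ≃ Z) (k l : K) : TC Z →ₗ[ℂ] TC X :=
  sandwich (slice e k) (slice e l)

/-- The map `E ⊗ I` on the trace class of `ℓ²(X) ⊗ ℓ²(K)`: it applies `E` to every block, that is,
`(I ⊗ ⟨k|) ((E ⊗ I) T) (I ⊗ |l⟩) = E ((I ⊗ ⟨k|) T (I ⊗ |l⟩))` for all `k, l`.
An operator is determined by its blocks, so there is at most one such map; it exists whenever `K`
is finite, and for arbitrary `K` whenever `E` is completely positive and trace-non-increasing. -/
def tensorId {X K Z : Type} (e : X × K ≃ Z) (E : SuperMap X) : SuperMap Z :=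
  theMap fun F => ∀ (T : TC Z) (k l : K), block e k l (F T) = E (block e k l T)

/-- Admissible superoperators: completely positive, trace-non-increasing linear maps. -/
structure IsSuperoperator {X : Type} (E : SuperMap X) : Prop where
  completelyPositive : ∀ (n : ℕ) (ρ : TC (X × Fin n)), 0 ≤ (ρ : Op (X × Fin n)) →
    0 ≤ (tensorId (Equiv.refl (X × Fin n)) E ρ : Op (X × Fin n))
  trace_le : ∀ ρ : TC X, IsPartialDensity ρ → (tr (E ρ : Op X)).re ≤ (tr (ρ : Op X)).re

/-- The least upper bound of a sequence of maps in the pointwise Löwner order on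
positive trace-class operators (a linear map is determined by its values there). -/
def supMap {X : Type} (E : ℕ → SuperMap X) : SuperMap X :=
  theMap fun F => ∀ ρ : TC X, 0 ≤ (ρ : Op X) →
    IsLUB (Set.range fun k => (E k ρ : Op X)) (F ρ : Op X)

/-- `E'` is the Schrödinger-Heisenberg dual of `E`: `tr (A E(ρ)) = tr (E'(A) ρ)`. -/
def IsDual {X : Type} (E : SuperMap X) (E' : Op X → Op X) : Prop :=
  ∀ (A : Op X) (ρ : TC X), tr (A * (E ρ : Op X)) = tr (E' A * (ρ : Op X))

/-- The `(Q, lam)`-diamond distance of `E` and `E'`: the supremum, over all auxiliary spaces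
`ℓ²(K)` and all density operators `ρ` on `ℓ²(X) ⊗ ℓ²(K)` with `tr ((Q ⊗ I) ρ) ≥ lam`, of the trace
distance of `(E ⊗ I)(ρ)` and `(E' ⊗ I)(ρ)`. -/
def diamondDist {X : Type} (Q : Op X) (lam : ℝ) (E E' : SuperMap X) : ℝ≥0∞ :=
  ⨆ (K : Type) (ρ : TC (X × K)) (_ : IsDensity ρ)
    (_ : lam ≤ (tr (tensorOp (Equiv.refl (X × K)) Q * (ρ : Op (X × K)))).re),
    traceDist (tensorId (Equiv.refl (X × K)) E ρ : Op (X × K))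
      (tensorId (Equiv.refl (X × K)) E' ρ)

/-! ## Quantum while-programs

`V` is the finite set of quantum variables; the state space of the variable `q` has the
orthonormal basis `|b⟩`, `b : B q` (for example `Bool` or `ℤ`), with initial state `|zero q⟩`. -/

section Programs

variable {V : Type} [DecidableEq V] {B : V → Type}

/-- The basis of the state space of the register `s`. -/
abbrev Reg (B : V → Type) (s : Finset V) : Type := ∀ q : {q // q ∈ s}, B q

/-- The basis of the state space of all variables. -/
abbrev Conf (B : V → Type) : Type := ∀ q, B q

/-- The decomposition of the whole space into the register `s` and the other variables. -/
def split (B : V → Type) (s : Finset V) :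
    Reg B s × (∀ q : {q // q ∉ s}, B q) ≃ Conf B :=
  (Equiv.piEquivPiSubtypeProd (fun q => q ∈ s) B).symm

/-- An operator on the register `s`, acting on the whole space. -/
def liftOp (s : Finset V) (A : Op (Reg B s)) : Op (Conf B) := tensorOp (split B s) A

/-- A superoperator on the register `s`, acting on the whole space. -/
def liftMap (s : Finset V) (E : SuperMap (Reg B s)) : SuperMap (Conf B) :=
  tensorId (split B s) E

/-- Measurements with `n` outcomes: `∑ₘ Mₘ† Mₘ = I`. -/
structure Measurement (X : Type) (n : ℕ) where
  op : Fin n → Op X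
  complete : ∑ m, star (op m) * op m = 1

/-- A measurement of the register `s`, on the whole space. -/
def Measurement.lift {s : Finset V} {n : ℕ} (M : Measurement (Reg B s) n) (m : Fin n) :
    Op (Conf B) := liftOp s (M.op m)

/-- Quantum while-programs: `skip`, `q := |0⟩`, `s := U[s]`, `P₁; P₂`,
`if M[s] = m → Pₘ fi`, and `while M[s] = 1 do P od`. -/
inductive Prog (B : V → Type) : Type
  | skip : Prog B
  | initVar (q : V) : Prog B
  | unitary (s : Finset V) (U : unitary (Op (Reg B s))) : Prog B
  | seq (P₁ P₂ : Prog B) : Prog B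
  | cases (s : Finset V) (n : ℕ) (M : Measurement (Reg B s) n) (P : Fin n → Prog B) : Prog B
  | loop (s : Finset V) (M : Measurement (Reg B s) 2) (P : Prog B) : Prog B

/-- Noisy quantum while-programs: as `Prog`, but a unitary application carries an error
probability `p` and an error model `Φ`, a superoperator on the register. -/
inductive NoisyProg (B : V → Type) : Type
  | skip : NoisyProg B
  | initVar (q : V) : NoisyProg B
  | unitary (s : Finset V) (U : unitary (Op (Reg B s))) (p : Set.Icc (0 : ℝ) 1)
      (Φ : {E : SuperMap (Reg B s) // IsSuperoperator E}) : NoisyProg B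
  | seq (P₁ P₂ : NoisyProg B) : NoisyProg B
  | cases (s : Finset V) (n : ℕ) (M : Measurement (Reg B s) n) (P : Fin n → NoisyProg B) :
      NoisyProg B
  | loop (s : Finset V) (M : Measurement (Reg B s) 2) (P : NoisyProg B) : NoisyProg B

/-- The ideal program: forget the noise. -/
def NoisyProg.ideal : NoisyProg B → Prog B
  | .skip => .skip
  | .initVar q => .initVar q
  | .unitary s U _ _ => .unitary s U
  | .seq P₁ P₂ => .seq P₁.ideal P₂.ideal
  | .cases s n M P => .cases s n M fun m => (P m).ideal
  | .loop s M P => .loop s M P.ideal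

/-- The initialization `ρ ↦ ∑ₙ (|0⟩⟨n| ⊗ I) ρ (|n⟩⟨0| ⊗ I)` of the variable `q`. -/
def initMap (zero : ∀ q, B q) (q : V) : SuperMap (Conf B) :=
  theMap fun F => ∀ ρ : TC (Conf B),
    HasSum (fun n : Reg B {q} =>
      (conj (liftOp {q} (ketBra (fun x => zero x) n)) ρ : Op (Conf B))) (F ρ : Op (Conf B))

/-- The denotation of the `k`-th unrolling of a loop with body `E` and measurement operators
`M₀`, `M₁`: the `0`-th unrolling aborts, and the `(k+1)`-st one measures, then terminates in case
of outcome `0` and in case of outcome `1` runs the body and then the `k`-th unrolling. -/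
def unrolling {X : Type} (M₀ M₁ : Op X) (E : SuperMap X) : ℕ → SuperMap X
  | 0 => 0
  | k + 1 => conj M₀ + unrolling M₀ M₁ E k ∘ₗ E ∘ₗ conj M₁

/-- Denotational semantics of quantum while-programs. -/
def Prog.sem (zero : ∀ q, B q) : Prog B → SuperMap (Conf B)
  | .skip => LinearMap.id
  | .initVar q => initMap zero q
  | .unitary s U => conj (liftOp s U.1)
  | .seq P₁ P₂ => P₂.sem zero ∘ₗ P₁.sem zero
  | .cases _ _ M P => ∑ m, (P m).sem zero ∘ₗ conj (M.lift m)
  | .loop _ M P => supMap (unrolling (M.lift 0) (M.lift 1) (P.sem zero))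

/-- Denotational semantics of noisy quantum while-programs. -/
def NoisyProg.sem (zero : ∀ q, B q) : NoisyProg B → SuperMap (Conf B)
  | .skip => LinearMap.id
  | .initVar q => initMap zero q
  | .unitary s U p Φ => (1 - ((p : ℝ) : ℂ)) • conj (liftOp s U.1) + ((p : ℝ) : ℂ) • liftMap s Φ.1
  | .seq P₁ P₂ => P₂.sem zero ∘ₗ P₁.sem zero
  | .cases _ _ M P => ∑ m, (P m).sem zero ∘ₗ conj (M.lift m)
  | .loop _ M P => supMap (unrolling (M.lift 0) (M.lift 1) (P.sem zero))

/-- The Hoare triple `{Q} P {R}`: `tr (Q ρ) ≤ tr (R ⟦P⟧ρ)` for all partial density operators. -/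
def Hoare (zero : ∀ q, B q) (Q : Op (Conf B)) (P : Prog B) (R : Op (Conf B)) : Prop :=
  ∀ ρ : TC (Conf B), IsPartialDensity ρ →
    (tr (Q * (ρ : Op (Conf B)))).re ≤ (tr (R * (P.sem zero ρ : Op (Conf B)))).re

/-- The loop `while M[s] = 1 do P od` is `(a, n)`-bounded: `0 ≤ a < 1`, `n ≥ 1` and
`(E*)ⁿ(M₁† M₁) ⊑ a M₁† M₁`, where `E*` is the dual of `E(ρ) = ⟦P⟧(M₁ ρ M₁†)`. -/
def LoopBounded (zero : ∀ q, B q) {s : Finset V} (M : Measurement (Reg B s) 2) (P : Prog B)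
    (a : ℝ) (n : ℕ) : Prop :=
  0 ≤ a ∧ a < 1 ∧ 1 ≤ n ∧ ∃ E' : Op (Conf B) → Op (Conf B),
    IsDual (P.sem zero ∘ₗ conj (M.lift 1)) E' ∧
    E'^[n] (star (M.lift 1) * M.lift 1) ≤ (a : ℂ) • (star (M.lift 1) * M.lift 1)

/-- The noisy program `P` is `ε`-robust under `(Q, lam)`. -/
structure Robust (zero : ∀ q, B q) (Q : Op (Conf B)) (lam : ℝ) (P : NoisyProg B) (ε : ℝ) :
    Prop where
  predicate : IsPredicate Q
  degree : lam ∈ Set.Icc (0 : ℝ) 1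
  nonneg : 0 ≤ ε
  dist_le : diamondDist Q lam (P.sem zero) (P.ideal.sem zero) ≤ ENNReal.ofReal ε

/-- Derivability of the judgment `(Q, lam) ⊢ P ≤ ε`. -/
inductive Derivable (zero : ∀ q, B q) : Op (Conf B) → ℝ → NoisyProg B → ℝ → Prop
  | skip {Q : Op (Conf B)} {lam : ℝ} (hQ : IsPredicate Q) (hlam : lam ∈ Set.Icc (0 : ℝ) 1) :
      Derivable zero Q lam .skip 0
  | initVar {Q : Op (Conf B)} {lam : ℝ} (q : V) (hQ : IsPredicate Q)
      (hlam : lam ∈ Set.Icc (0 : ℝ) 1) : Derivable zero Q lam (.initVar q) 0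
  | unitary {Q : Op (Conf B)} {lam ε : ℝ} {s : Finset V} {U : unitary (Op (Reg B s))}
      {p : Set.Icc (0 : ℝ) 1} {Φ : {E : SuperMap (Reg B s) // IsSuperoperator E}}
      (hQ : IsPredicate Q) (hlam : lam ∈ Set.Icc (0 : ℝ) 1) (hε : 0 ≤ ε)
      (h : diamondDist Q lam (conj (liftOp s U.1)) (liftMap s Φ.1) ≤ ENNReal.ofReal ε) :
      Derivable zero Q lam (.unitary s U p Φ) ((p : ℝ) * ε)
  | weaken {Q Q' : Op (Conf B)} {lam lam' ε ε' : ℝ} {P : NoisyProg B} (hQ : IsPredicate Q)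
      (hlam : lam ∈ Set.Icc (0 : ℝ) 1) (h : Derivable zero Q' lam' P ε') (hε : ε' ≤ ε)
      (hQQ' : Q ≤ Q') (hlam' : lam' ≤ lam) : Derivable zero Q lam P ε
  | rescale {Q : Op (Conf B)} {lam δ ε : ℝ} {P : NoisyProg B} (hδ : 0 < δ)
      (h : Derivable zero ((δ⁻¹ : ℂ) • Q) (lam / δ) P ε) (hQ : IsPredicate Q)
      (hQδ : IsPredicate ((δ⁻¹ : ℂ) • Q)) (hlam : lam ∈ Set.Icc (0 : ℝ) 1)
      (hlamδ : lam / δ ∈ Set.Icc (0 : ℝ) 1) : Derivable zero Q lam P ε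
  | seq {Q₁ Q₂ : Op (Conf B)} {lam ε₁ ε₂ : ℝ} {P₁ P₂ : NoisyProg B}
      (h₁ : Derivable zero Q₁ lam P₁ ε₁) (h₂ : Derivable zero Q₂ lam P₂ ε₂)
      (h : Hoare zero Q₁ P₁.ideal Q₂) : Derivable zero Q₁ lam (.seq P₁ P₂) (ε₁ + ε₂)
  | cases {s : Finset V} {n : ℕ} {M : Measurement (Reg B s) n} {P : Fin n → NoisyProg B}
      {Q : Fin n → Op (Conf B)} {t δ ε : ℝ} (ht : t ∈ Set.Icc (0 : ℝ) 1)
      (hδ : δ ∈ Set.Icc (0 : ℝ) 1) (h : ∀ m, Derivable zero (Q m) (1 - δ) (P m) ε) :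
      Derivable zero (∑ m, star (M.lift m) * Q m * M.lift m) (1 - t * δ) (.cases s n M P)
        ((1 - t) * ε + t)
  | whileBounded {s : Finset V} {M : Measurement (Reg B s) 2} {P : NoisyProg B}
      {Q : Op (Conf B)} {lam ε a : ℝ} {n : ℕ} (h : Derivable zero Q lam P ε)
      (hH : Hoare zero Q P.ideal ((lam : ℂ) • (star (M.lift 0) * M.lift 0)
        + star (M.lift 1) * Q * M.lift 1))
      (hb : LoopBounded zero M P.ideal a n) :
      Derivable zero ((lam : ℂ) • (star (M.lift 0) * M.lift 0) + star (M.lift 1) * Q * M.lift 1)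
        lam (.loop s M P) (n * ε / (1 - a))
  | whileUnbounded {s : Finset V} {M : Measurement (Reg B s) 2} {P : NoisyProg B}
      {Q : Op (Conf B)} {lam : ℝ} (hQ : IsPredicate Q) (hlam : lam ∈ Set.Icc (0 : ℝ) 1) :
      Derivable zero Q lam (.loop s M P) 1

end Programs

end QRobust

end

/-!
The rules are sound because every error estimate can be carried out with positive trace-class
operators alone, on the whole space together with an arbitrary auxiliary space.

*Trace norm.* For a difference `T = A - B` of positive trace-class operators, `‖T‖₁ ≤ c` holds if
and only if `T` can be written as such a difference with `tr A + tr B ≤ c`; the optimal choice is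
the Jordan decomposition (`HermLE`, `HermLE.traceNorm_le`, `HermLE.of_traceNorm_le`). In this form the
triangle inequality, the contractivity of positive trace-non-increasing maps (`HermLE.map`) and
lower semicontinuity under weak operator limits (`HermLE.wlim`) are immediate; the last point uses
that positive operators of bounded trace are weakly compact (`exists_wlim_nonneg`).

*Existence of the maps.* All maps involved are completely positive for arbitrary auxiliary spaces
(`CP`) and trace-non-increasing (`TNI`). For the error models, complete positivity is given only for
finite auxiliary spaces; for an infinite one `E ⊗ I` is the weak limit of its finite compressions
(`IsSuperoperator.cp`). Initializations are norm-convergent Kraus sums (`exists_kraus`). The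
unrollings of a loop increase, so their least upper bound exists and is their weak limit
(`supMap_wlim`), and tensoring with an identity commutes with that limit (`wlim_tensorId`).

*The rules.* Robustness is put into a homogeneous form, for positive operators of any trace
(`DistLE`), and each rule is proved in that form. For a sequence, the error of the second part is
evaluated on the ideal output of the first, which satisfies the intermediate predicate by the Hoare
triple (`DistLE.comp`). For a case statement, Markov's inequality bounds by `t` the weight of the
branches whose input violates its predicate; there the error is at most one (`DistLE.measure`). For
a bounded loop, the Hoare triple makes the precondition an invariant, so that the iterations
contribute at most `ε x_0, ε x_1, …`, where `x_j` is the weight of the ideal state that enters the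
body for the `(j + 1)`-st time; boundedness gives `x_{j+n} ≤ a x_j`, hence `∑ x_j ≤ n / (1 - a)`,
and this bound on all unrollings passes to the weak limit (`DistLE.loop`).
-/

noncomputable section

namespace QRobust
open Filter Topology ContinuousLinearMap

/-! ### Basis vectors and matrix entries -/

theorem coord_ket_self {X : Type} (x : X) : (ket x).coord x = 1 := by
  classical
  unfold ket Ell2.coord
  exact lp.single_apply_self (E := fun _ : X => ℂ) 2 x (1 : ℂ)

theorem coord_ket_of_ne {X : Type} {x y : X} (h : y ≠ x) : (ket x).coord y = 0 := by
  classical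
  unfold ket Ell2.coord
  exact lp.single_apply_ne (E := fun _ : X => ℂ) 2 x (1 : ℂ) h

theorem inner_ket_self {X : Type} (x : X) : ⟪ket x, ket x⟫_ℂ = 1 := by
  rw [Ell2.inner_ket, coord_ket_self]

theorem norm_ket {X : Type} (x : X) : ‖ket x‖ = 1 := by
  have h := inner_self_eq_norm_sq (𝕜 := ℂ) (ket x)
  rw [inner_ket_self] at h
  have h2 : ‖ket x‖ ^ 2 = 1 := by simpa using h.symm
  exact (pow_eq_one_iff_of_nonneg (norm_nonneg _) two_ne_zero).1 h2

theorem vec_ext {X : Type} {f g : Ell2 X} (h : ∀ x, ⟪ket x, f⟫_ℂ = ⟪ket x, g⟫_ℂ) : f = g :=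
  Ell2.ext fun x => by simpa only [Ell2.inner_ket] using h x

theorem op_ext {X Y : Type} {A B : Ell2 X →L[ℂ] Ell2 Y}
    (h : ∀ y x, ⟪ket y, A (ket x)⟫_ℂ = ⟪ket y, B (ket x)⟫_ℂ) : A = B := by
  ext f
  refine vec_ext fun y => ?_
  rw [← adjoint_inner_left, ← adjoint_inner_left]
  congr 1
  refine vec_ext fun x => ?_
  rw [adjoint_inner_right, adjoint_inner_right, ← inner_conj_symm, h, inner_conj_symm]

/-! ### Positive operators -/

theorem sqrt_adjoint {X : Type} (A : Op X) : (CFC.sqrt A).adjoint = CFC.sqrt A :=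
  (CFC.sqrt_nonneg A).isSelfAdjoint.star_eq

theorem inner_eq_inner_sqrt {X : Type} {A : Op X} (hA : 0 ≤ A) (f g : Ell2 X) :
    ⟪f, A g⟫_ℂ = ⟪CFC.sqrt A f, CFC.sqrt A g⟫_ℂ := by
  conv_lhs => rw [← CFC.sqrt_mul_sqrt_self A hA]
  change ⟪f, CFC.sqrt A (CFC.sqrt A g)⟫_ℂ = _
  rw [← adjoint_inner_left, sqrt_adjoint]

theorem inner_self_eq_norm_sqrt {X : Type} {A : Op X} (hA : 0 ≤ A) (f : Ell2 X) :
    ⟪f, A f⟫_ℂ = ((‖CFC.sqrt A f‖ ^ 2 : ℝ) : ℂ) := by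
  rw [inner_eq_inner_sqrt hA, inner_self_eq_norm_sq_to_K]
  push_cast
  rfl

theorem re_inner_eq_norm_sqrt {X : Type} {A : Op X} (hA : 0 ≤ A) (f : Ell2 X) :
    (⟪f, A f⟫_ℂ).re = ‖CFC.sqrt A f‖ ^ 2 := by
  rw [inner_self_eq_norm_sqrt hA, Complex.ofReal_re]

theorem re_inner_nonneg {X : Type} {A : Op X} (hA : 0 ≤ A) (f : Ell2 X) :
    0 ≤ (⟪f, A f⟫_ℂ).re := by
  rw [re_inner_eq_norm_sqrt hA]; positivity

theorem im_inner_eq_zero {X : Type} {A : Op X} (hA : 0 ≤ A) (f : Ell2 X) :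
    (⟪f, A f⟫_ℂ).im = 0 := by
  rw [inner_self_eq_norm_sqrt hA, Complex.ofReal_im]

theorem nonneg_of_inner {X : Type} {A : Op X} (h : ∀ f, 0 ≤ (⟪f, A f⟫_ℂ).re)
    (h' : ∀ f, (⟪f, A f⟫_ℂ).im = 0) : 0 ≤ A := by
  rw [nonneg_iff_isPositive, isPositive_iff_complex]
  intro f
  have h1 : ⟪A f, f⟫_ℂ = (starRingEnd ℂ) ⟪f, A f⟫_ℂ := (inner_conj_symm _ _).symm
  have h2 : (⟪A f, f⟫_ℂ).im = 0 := by rw [h1, Complex.conj_im, h' f, neg_zero]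
  have h3 : (⟪A f, f⟫_ℂ).re = (⟪f, A f⟫_ℂ).re := by rw [h1, Complex.conj_re]
  exact ⟨Complex.ext rfl h2.symm, (h f).trans_eq h3.symm⟩

theorem re_inner_mono {X : Type} {A B : Op X} (h : A ≤ B) (f : Ell2 X) :
    (⟪f, A f⟫_ℂ).re ≤ (⟪f, B f⟫_ℂ).re := by
  have := re_inner_nonneg (sub_nonneg.2 h) f
  rw [sub_apply, inner_sub_right, Complex.sub_re] at this
  linarith

theorem smul_op_nonneg {X : Type} {A : Op X} (hA : 0 ≤ A) {r : ℝ} (hr : 0 ≤ r) :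
    0 ≤ (r : ℂ) • A := by
  refine nonneg_of_inner (fun f => ?_) (fun f => ?_)
  · rw [smul_apply, inner_smul_right, Complex.re_ofReal_mul]
    exact mul_nonneg hr (re_inner_nonneg hA f)
  · rw [smul_apply, inner_smul_right, Complex.im_ofReal_mul, im_inner_eq_zero hA, mul_zero]

/-! ### The trace of positive operators -/

/-- The trace of a positive operator, with values in `[0, ∞]`. (For other operators the negative
parts of the diagonal entries are ignored.) -/
def etr {X : Type} (A : Op X) : ℝ≥0∞ := ∑' x, ENNReal.ofReal (⟪ket x, A (ket x)⟫_ℂ).re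

theorem traceNorm_eq_etr {X : Type} (A : Op X) : traceNorm A = etr (CFC.abs A) := rfl

theorem etr_mono {X : Type} {A B : Op X} (h : A ≤ B) : etr A ≤ etr B :=
  ENNReal.tsum_le_tsum fun _ => ENNReal.ofReal_le_ofReal (re_inner_mono h _)

theorem etr_add {X : Type} {A B : Op X} (hA : 0 ≤ A) (hB : 0 ≤ B) :
    etr (A + B) = etr A + etr B := by
  unfold etr
  rw [← ENNReal.tsum_add]
  refine tsum_congr fun x => ?_
  rw [add_apply, inner_add_right, Complex.add_re,
    ENNReal.ofReal_add (re_inner_nonneg hA _) (re_inner_nonneg hB _)]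

theorem etr_conj {X Y : Type} {A : Op X} (hA : 0 ≤ A) (W : Ell2 X →L[ℂ] Ell2 Y) :
    etr (W ∘L A ∘L W.adjoint) = ∑' x, ENNReal.ofReal (‖W (CFC.sqrt A (ket x))‖ ^ 2) := by
  have h := sum_norm_adjoint (W ∘L CFC.sqrt A)
  rw [adjoint_comp, sqrt_adjoint] at h
  unfold etr
  simp_rw [diag_eq hA W, Complex.ofReal_re]
  exact h

theorem etr_eq_sum_sqrt {X : Type} {A : Op X} (hA : 0 ≤ A) :
    etr A = ∑' x, ENNReal.ofReal (‖CFC.sqrt A (ket x)‖ ^ 2) :=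
  tsum_congr fun _ => by rw [re_inner_eq_norm_sqrt hA]

theorem etr_conj_le {X Y : Type} {A : Op X} (hA : 0 ≤ A) (W : Ell2 X →L[ℂ] Ell2 Y)
    (hW : ‖W‖ ≤ 1) : etr (W ∘L A ∘L W.adjoint) ≤ etr A := by
  rw [etr_conj hA, etr_eq_sum_sqrt hA]
  refine ENNReal.tsum_le_tsum fun x => ENNReal.ofReal_le_ofReal ?_
  refine pow_le_pow_left₀ (norm_nonneg _) ?_ 2
  exact (W.le_opNorm _).trans (mul_le_of_le_one_left (norm_nonneg _) hW)

/-- The matrix elements of a positive operator are bounded by its trace: the Hilbert-Schmidt norm of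
`√A`, whose square is the trace of `A`, bounds the operator norm of `√A`. -/
theorem norm_inner_le_etr {X : Type} {A : Op X} (hA : 0 ≤ A) (f g : Ell2 X) :
    ENNReal.ofReal ‖⟪f, A g⟫_ℂ‖ ≤ ENNReal.ofReal (‖f‖ * ‖g‖) * etr A := by
  have key : ∀ g : Ell2 X, ENNReal.ofReal (‖CFC.sqrt A g‖ ^ 2)
      ≤ ENNReal.ofReal (‖g‖ ^ 2) * etr A := by
    intro g
    rw [Ell2.ofReal_norm_sq (CFC.sqrt A g), etr_eq_sum_sqrt hA, ← ENNReal.tsum_mul_left]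
    refine ENNReal.tsum_le_tsum fun x => ?_
    rw [← ENNReal.ofReal_mul (by positivity), ← mul_pow]
    refine ENNReal.ofReal_le_ofReal (pow_le_pow_left₀ (norm_nonneg _) ?_ 2)
    have : ⟪ket x, CFC.sqrt A g⟫_ℂ = ⟪CFC.sqrt A (ket x), g⟫_ℂ := by
      rw [← adjoint_inner_left, sqrt_adjoint]
    rw [this, mul_comm]
    exact norm_inner_le_norm _ _
  by_cases ht : etr A = ∞
  · rcases eq_or_ne (‖f‖ * ‖g‖) 0 with h0 | h0
    · have : ‖⟪f, A g⟫_ℂ‖ = 0 := by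
        rcases mul_eq_zero.1 h0 with h | h
        · rw [norm_eq_zero.1 h]; simp
        · rw [norm_eq_zero.1 h]; simp
      rw [this]; simp
    · have : ENNReal.ofReal (‖f‖ * ‖g‖) ≠ 0 := by
        rw [Ne, ENNReal.ofReal_eq_zero, not_le]
        positivity
      rw [ht, ENNReal.mul_top this]
      exact le_top
  · obtain ⟨t, ht0, ht⟩ : ∃ t : ℝ, 0 ≤ t ∧ etr A = ENNReal.ofReal t :=
      ⟨_, ENNReal.toReal_nonneg, (ENNReal.ofReal_toReal ht).symm⟩
    have key2 : ∀ g : Ell2 X, ‖CFC.sqrt A g‖ ≤ ‖g‖ * Real.sqrt t := by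
      intro g
      have := key g
      rw [ht, ← ENNReal.ofReal_mul (by positivity), ENNReal.ofReal_le_ofReal_iff (by positivity)]
        at this
      refine (pow_le_pow_iff_left₀ (norm_nonneg _) (by positivity) two_ne_zero).1 ?_
      rwa [mul_pow, Real.sq_sqrt ht0]
    rw [ht, ← ENNReal.ofReal_mul (by positivity)]
    refine ENNReal.ofReal_le_ofReal ?_
    rw [inner_eq_inner_sqrt hA]
    calc _ ≤ ‖CFC.sqrt A f‖ * ‖CFC.sqrt A g‖ := norm_inner_le_norm _ _
      _ ≤ (‖f‖ * Real.sqrt t) * (‖g‖ * Real.sqrt t) :=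
        mul_le_mul (key2 f) (key2 g) (norm_nonneg _) (by positivity)
      _ = ‖f‖ * ‖g‖ * t := by
        rw [mul_mul_mul_comm, Real.mul_self_sqrt ht0]

/-! ### Trace-class operators -/

theorem mem_TC_of_etr {X : Type} {A : Op X} (hA : 0 ≤ A) (h : etr A ≠ ∞) : A ∈ TC X := by
  refine Submodule.subset_span ⟨hA, ?_⟩
  have h1 := ENNReal.summable_toReal h
  have h2 : ∀ x, ⟪ket x, A (ket x)⟫_ℂ
      = (((ENNReal.ofReal (⟪ket x, A (ket x)⟫_ℂ).re).toReal : ℝ) : ℂ) := by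
    intro x
    rw [ENNReal.toReal_ofReal (re_inner_nonneg hA _)]
    exact Complex.ext rfl (im_inner_eq_zero hA _)
  exact (summable_congr h2).2 (Complex.summable_ofReal.2 h1)

theorem TC.summable {X : Type} {T : Op X} (hT : T ∈ TC X) :
    Summable fun x => ⟪ket x, T (ket x)⟫_ℂ := by
  induction hT using Submodule.span_induction with
  | mem ρ h => exact h.2
  | zero => simp
  | add A B _ _ hA hB => simpa [inner_add_right] using hA.add hB
  | smul c A _ hA => simpa [inner_smul_right] using hA.mul_left c

theorem tr_add {X : Type} (A B : TC X) :
    tr ((A + B : TC X) : Op X) = tr (A : Op X) + tr (B : Op X) := by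
  unfold tr
  rw [← (TC.summable A.2).tsum_add (TC.summable B.2)]
  exact tsum_congr fun x => by simp

theorem tr_smul {X : Type} (c : ℂ) (A : Op X) : tr (c • A) = c * tr A := by
  unfold tr
  rw [← tsum_mul_left]
  exact tsum_congr fun x => by simp

theorem tr_re {X : Type} {T : Op X} (hT : T ∈ TC X) :
    (tr T).re = ∑' x, (⟪ket x, T (ket x)⟫_ℂ).re :=
  Complex.re_tsum (TC.summable hT)

theorem etr_eq {X : Type} {T : Op X} (hT : T ∈ TC X) (h0 : 0 ≤ T) :
    etr T = ENNReal.ofReal (tr T).re := by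
  rw [tr_re hT, ENNReal.ofReal_tsum_of_nonneg (fun x => re_inner_nonneg h0 _)
    (Complex.hasSum_re (TC.summable hT).hasSum).summable]
  rfl

theorem tr_nonneg {X : Type} {T : Op X} (hT : T ∈ TC X) (h0 : 0 ≤ T) : 0 ≤ (tr T).re := by
  rw [tr_re hT]
  exact tsum_nonneg fun x => re_inner_nonneg h0 _

theorem tr_im {X : Type} {T : Op X} (hT : T ∈ TC X) (h0 : 0 ≤ T) : (tr T).im = 0 := by
  unfold tr
  rw [Complex.im_tsum (TC.summable hT)]
  simp [im_inner_eq_zero h0]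

theorem norm_inner_le_tr {X : Type} {T : Op X} (hT : T ∈ TC X) (h0 : 0 ≤ T) (f g : Ell2 X) :
    ‖⟪f, T g⟫_ℂ‖ ≤ ‖f‖ * ‖g‖ * (tr T).re := by
  have h := norm_inner_le_etr h0 f g
  have h1 := tr_nonneg hT h0
  rwa [etr_eq hT h0, ← ENNReal.ofReal_mul (by positivity),
    ENNReal.ofReal_le_ofReal_iff (by positivity)] at h

theorem eq_zero_of_tr_eq_zero {X : Type} {T : Op X} (hT : T ∈ TC X) (h0 : 0 ≤ T)
    (h : (tr T).re = 0) : T = 0 := by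
  refine op_ext fun y x => ?_
  have := norm_inner_le_tr hT h0 (ket y) (ket x)
  rw [h, mul_zero] at this
  simpa using this

theorem norm_le_tr {X : Type} {T : Op X} (hT : T ∈ TC X) (h0 : 0 ≤ T) : ‖T‖ ≤ (tr T).re := by
  refine opNorm_le_bound _ (tr_nonneg hT h0) fun f => ?_
  have h := norm_inner_le_tr hT h0 (T f) f
  rw [inner_self_eq_norm_sq_to_K] at h
  have h2 : ‖T f‖ ^ 2 ≤ ‖T f‖ * ‖f‖ * (tr T).re := by
    simpa using h
  rcases eq_or_ne (‖T f‖) 0 with h3 | h3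
  · rw [h3]
    exact mul_nonneg (tr_nonneg hT h0) (norm_nonneg _)
  · have h4 : 0 < ‖T f‖ := lt_of_le_of_ne (norm_nonneg _) (Ne.symm h3)
    nlinarith

/-- The Hilbert-Schmidt inner product of two operators is that of their adjoints, in reverse order;
both are sums of the same absolutely summable family of products of matrix entries. -/
theorem sum_inner_adjoint {X Y : Type} (S T : Ell2 X →L[ℂ] Ell2 Y)
    (hS : Summable fun x => ‖S (ket x)‖ ^ 2) (hT : Summable fun x => ‖T (ket x)‖ ^ 2) :
    ∑' x, ⟪S (ket x), T (ket x)⟫_ℂ = ∑' y, ⟪T.adjoint (ket y), S.adjoint (ket y)⟫_ℂ := by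
  have hs : Summable fun p : X × Y => ‖⟪ket p.2, S (ket p.1)⟫_ℂ‖ ^ 2 := by
    refine (summable_prod_of_nonneg (fun p => by positivity)).2 ⟨fun x => ?_, ?_⟩
    · simpa [Ell2.inner_ket] using (S (ket x)).summable_sq
    · simpa [Ell2.inner_ket, ← Ell2.norm_sq] using hS
  have ht : Summable fun p : X × Y => ‖⟪ket p.2, T (ket p.1)⟫_ℂ‖ ^ 2 := by
    refine (summable_prod_of_nonneg (fun p => by positivity)).2 ⟨fun x => ?_, ?_⟩
    · simpa [Ell2.inner_ket] using (T (ket x)).summable_sq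
    · simpa [Ell2.inner_ket, ← Ell2.norm_sq] using hT
  have h : Summable (Function.uncurry fun (x : X) (y : Y) =>
      (starRingEnd ℂ) ⟪ket y, S (ket x)⟫_ℂ * ⟪ket y, T (ket x)⟫_ℂ) := by
    refine Summable.of_norm_bounded (hs.add ht) fun p => ?_
    rw [Function.uncurry_apply_pair, norm_mul, RCLike.norm_conj]
    nlinarith [sq_nonneg (‖⟪ket p.2, S (ket p.1)⟫_ℂ‖ - ‖⟪ket p.2, T (ket p.1)⟫_ℂ‖),
      norm_nonneg ⟪ket p.2, S (ket p.1)⟫_ℂ, norm_nonneg ⟪ket p.2, T (ket p.1)⟫_ℂ]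
  calc ∑' x, ⟪S (ket x), T (ket x)⟫_ℂ
      = ∑' x, ∑' y, (starRingEnd ℂ) ⟪ket y, S (ket x)⟫_ℂ * ⟪ket y, T (ket x)⟫_ℂ := by
        refine tsum_congr fun x => ?_
        rw [Ell2.inner_eq]
        refine tsum_congr fun y => ?_
        rw [Ell2.inner_ket, Ell2.inner_ket, RCLike.inner_apply, mul_comm]
    _ = ∑' y, ∑' x, (starRingEnd ℂ) ⟪ket y, S (ket x)⟫_ℂ * ⟪ket y, T (ket x)⟫_ℂ :=
        (h.tsum_comm).symm
    _ = _ := by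
        refine tsum_congr fun y => ?_
        rw [Ell2.inner_eq]
        refine tsum_congr fun x => ?_
        rw [← Ell2.inner_ket, ← Ell2.inner_ket, adjoint_inner_right, adjoint_inner_right,
          RCLike.inner_apply, inner_conj_symm, inner_conj_symm]

theorem summable_norm_sqrt {X Y : Type} {ρ : Op X} (hρ : 0 ≤ ρ) (h : etr ρ ≠ ∞)
    (V : Ell2 X →L[ℂ] Ell2 Y) : Summable fun x => ‖V (CFC.sqrt ρ (ket x))‖ ^ 2 := by
  rw [etr_eq_sum_sqrt hρ] at h
  have h1 : Summable fun x => ‖CFC.sqrt ρ (ket x)‖ ^ 2 := by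
    simpa [ENNReal.toReal_ofReal] using ENNReal.summable_toReal h
  refine Summable.of_nonneg_of_le (fun _ => by positivity) (fun x => ?_) (h1.mul_left (‖V‖ ^ 2))
  rw [← mul_pow]
  exact pow_le_pow_left₀ (norm_nonneg _) (V.le_opNorm _) 2

theorem etr_ne_top {X : Type} {ρ : Op X} (hT : ρ ∈ TC X) (hρ : 0 ≤ ρ) : etr ρ ≠ ∞ := by
  rw [etr_eq hT hρ]; exact ENNReal.ofReal_ne_top

/-- Cyclicity of the trace. For `T = √T √T` positive, both sides are Hilbert-Schmidt inner products
of operators with a factor `√T`; the general case follows by linearity. -/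
theorem tr_sandwich {X Y : Type} (V W : Ell2 X →L[ℂ] Ell2 Y) {T : Op X} (hT : T ∈ TC X) :
    tr (V ∘L T ∘L W.adjoint) = tr (W.adjoint ∘L V ∘L T) := by
  have mem1 : ∀ {A : Op X}, A ∈ TC X → V ∘L A ∘L W.adjoint ∈ TC Y := fun h => sandwich_mem V W h
  have mem2 : ∀ {A : Op X}, A ∈ TC X → W.adjoint ∘L V ∘L A ∈ TC X := fun {A} h => by
    have := sandwich_mem (W.adjoint ∘L V) (1 : Op X) h
    rwa [show adjoint (1 : Op X) = 1 from star_one (Op X)] at this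
  unfold TC at hT
  induction hT using Submodule.span_induction with
  | mem ρ h =>
    have h0 := h.1
    have hm : ρ ∈ TC X := Submodule.subset_span h
    have he := etr_ne_top hm h0
    have h1 := sum_inner_adjoint (V ∘L CFC.sqrt ρ) (W ∘L CFC.sqrt ρ)
      (summable_norm_sqrt h0 he V) (summable_norm_sqrt h0 he W)
    rw [adjoint_comp, adjoint_comp, sqrt_adjoint] at h1
    have h2 := sum_inner_adjoint (CFC.sqrt ρ) (W.adjoint ∘L V ∘L CFC.sqrt ρ)
      (summable_norm_sqrt h0 he (ContinuousLinearMap.id ℂ _))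
      (summable_norm_sqrt h0 he (W.adjoint ∘L V))
    have h3 : tr (V ∘L ρ ∘L W.adjoint)
        = ∑' y, ⟪CFC.sqrt ρ (V.adjoint (ket y)), CFC.sqrt ρ (W.adjoint (ket y))⟫_ℂ := by
      refine tsum_congr fun y => ?_
      rw [← inner_eq_inner_sqrt h0, adjoint_inner_left]
      rfl
    have h4 : tr (W.adjoint ∘L V ∘L ρ) = ∑' x, ⟪(W.adjoint ∘L V ∘L CFC.sqrt ρ).adjoint (ket x),
        (CFC.sqrt ρ).adjoint (ket x)⟫_ℂ := by
      refine tsum_congr fun x => ?_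
      rw [adjoint_inner_left, sqrt_adjoint]
      conv_lhs => rw [← CFC.sqrt_mul_sqrt_self ρ h0]
      rfl
    rw [h3, h4, ← h2]
    have h5 := sum_inner_adjoint (W ∘L CFC.sqrt ρ) (V ∘L CFC.sqrt ρ)
      (summable_norm_sqrt h0 he W) (summable_norm_sqrt h0 he V)
    rw [adjoint_comp, adjoint_comp, sqrt_adjoint] at h5
    refine h5.symm.trans (tsum_congr fun x => ?_)
    simp only [comp_apply]
    rw [adjoint_inner_right]
  | zero => simp [tr]
  | add A B ha hb hA hB =>
    have e1 : V ∘L (A + B) ∘L W.adjoint = V ∘L A ∘L W.adjoint + V ∘L B ∘L W.adjoint := by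
      ext f; simp
    have e2 : W.adjoint ∘L V ∘L (A + B) = W.adjoint ∘L V ∘L A + W.adjoint ∘L V ∘L B := by
      ext f; simp
    rw [e1, e2]
    exact (tr_add ⟨_, mem1 ha⟩ ⟨_, mem1 hb⟩).trans
      ((congrArg₂ _ hA hB).trans (tr_add ⟨_, mem2 ha⟩ ⟨_, mem2 hb⟩).symm)
  | smul c A _ hA =>
    have e1 : V ∘L (c • A) ∘L W.adjoint = c • (V ∘L A ∘L W.adjoint) := by
      ext f; simp
    have e2 : W.adjoint ∘L V ∘L (c • A) = c • (W.adjoint ∘L V ∘L A) := by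
      ext f; simp
    rw [e1, e2, tr_smul, tr_smul, hA]

/-! ### Differences of positive trace-class operators -/

/-- `T` is a difference of two positive trace-class operators whose traces add up to at most `c`.
For a Hermitian trace-class operator this says that its trace norm is at most `c`. -/
def HermLE {X : Type} (T : Op X) (c : ℝ) : Prop :=
  ∃ A B : TC X, 0 ≤ (A : Op X) ∧ 0 ≤ (B : Op X) ∧ T = A - B ∧
    (tr (A : Op X)).re + (tr (B : Op X)).re ≤ c

/-- If `P` and `N` are positive with orthogonal ranges, and `P - N = A - B` with `A`, `B` positive,
then compressing to the closure of the range of `P` shows `tr P ≤ tr A`. -/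
theorem etr_le_of_sub_eq_sub {X : Type} {P N A B : Op X} (hP : 0 ≤ P)
    (hA : 0 ≤ A) (hB : 0 ≤ B) (hPN : P * N = 0) (h : P - N = A - B) : etr P ≤ etr A := by
  let K : Submodule ℂ (Ell2 X) := (LinearMap.range (P : Ell2 X →ₗ[ℂ] Ell2 X)).topologicalClosure
  have hPa : P.adjoint = P := hP.isSelfAdjoint.star_eq
  have hK : K.starProjection.adjoint = K.starProjection :=
    (isSelfAdjoint_starProjection K).star_eq
  have h1 : K.starProjection ∘L P = P := by
    ext1 f
    exact Submodule.starProjection_eq_self_iff.2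
      (Submodule.le_topologicalClosure _ ⟨f, rfl⟩)
  have h2 : P ∘L K.starProjection = P := by
    have := congrArg ContinuousLinearMap.adjoint h1
    rwa [adjoint_comp, hK, hPa] at this
  have h3 : K.starProjection ∘L N = 0 := by
    ext1 f
    refine (Submodule.starProjection_apply_eq_zero_iff K).2 ?_
    rw [Submodule.orthogonal_closure, Submodule.mem_orthogonal]
    rintro _ ⟨g, rfl⟩
    change ⟪P g, N f⟫_ℂ = 0
    rw [← adjoint_inner_right, hPa]
    have : P (N f) = 0 := congrArg (fun T : Op X => T f) hPN
    rw [this, inner_zero_right]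
  have h4 : P = K.starProjection ∘L A ∘L K.starProjection.adjoint
      - K.starProjection ∘L B ∘L K.starProjection.adjoint := by
    have : K.starProjection ∘L (P - N) ∘L K.starProjection
        = K.starProjection ∘L (A - B) ∘L K.starProjection := by rw [h]
    rw [sub_comp, sub_comp, comp_sub, comp_sub, h2, h1, ← comp_assoc _ N, h3, zero_comp,
      sub_zero] at this
    rw [hK]
    exact this
  calc etr P ≤ etr (K.starProjection ∘L A ∘L K.starProjection.adjoint) := by
        refine etr_mono ?_
        conv_lhs => rw [h4]
        exact sub_le_self _ (conj_nonneg hB _)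
    _ ≤ etr A := etr_conj_le hA _ K.starProjection_norm_le

theorem HermLE.isSelfAdjoint {X : Type} {T : Op X} {c : ℝ} (h : HermLE T c) :
    IsSelfAdjoint T := by
  obtain ⟨A, B, hA, hB, rfl, -⟩ := h
  exact hA.isSelfAdjoint.sub hB.isSelfAdjoint

theorem abs_eq_posPart_add_negPart {X : Type} {T : Op X} (h : IsSelfAdjoint T) :
    CFC.abs T = T⁺ + T⁻ := by
  have h1 := CFC.abs_sub_self T h
  have h2 := CFC.posPart_sub_negPart T h
  rw [sub_eq_iff_eq_add] at h1
  rw [h1]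
  nth_rw 2 [← h2]
  rw [two_smul]
  abel

/-- Among all decompositions `T = A - B` the Jordan decomposition has the smallest traces. -/
theorem HermLE.etr_posPart_add {X : Type} {T : Op X} {c : ℝ} (h : HermLE T c) :
    etr T⁺ + etr T⁻ ≤ ENNReal.ofReal c := by
  have hs := h.isSelfAdjoint
  obtain ⟨A, B, hA, hB, hT, hc⟩ := h
  have h2 := CFC.posPart_sub_negPart T hs
  have h3 : etr T⁺ ≤ etr (A : Op X) :=
    etr_le_of_sub_eq_sub (CFC.posPart_nonneg T) hA hB (CFC.posPart_mul_negPart T) (h2.trans hT)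
  have h4 : etr T⁻ ≤ etr (B : Op X) :=
    etr_le_of_sub_eq_sub (CFC.negPart_nonneg T) hB hA (CFC.negPart_mul_posPart T) (by
      rw [← neg_sub, h2, hT, neg_sub])
  refine (add_le_add h3 h4).trans ?_
  rw [etr_eq A.2 hA, etr_eq B.2 hB, ← ENNReal.ofReal_add (tr_nonneg A.2 hA) (tr_nonneg B.2 hB)]
  exact ENNReal.ofReal_le_ofReal hc

theorem HermLE.traceNorm_le {X : Type} {T : Op X} {c : ℝ} (h : HermLE T c) :
    traceNorm T ≤ ENNReal.ofReal c := by
  rw [traceNorm_eq_etr, abs_eq_posPart_add_negPart h.isSelfAdjoint,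
    etr_add (CFC.posPart_nonneg T) (CFC.negPart_nonneg T)]
  exact h.etr_posPart_add

/-- Conversely, the trace norm is attained by the Jordan decomposition. The hypothesis `h₀`, whose
bound `c₀` is irrelevant, says that `T` is Hermitian and trace-class. -/
theorem HermLE.of_traceNorm_le {X : Type} {T : Op X} {c₀ c : ℝ} (h₀ : HermLE T c₀)
    (h : traceNorm T ≤ ENNReal.ofReal c) (hc : 0 ≤ c) : HermLE T c := by
  have h1 := h₀.etr_posPart_add
  rw [traceNorm_eq_etr, abs_eq_posPart_add_negPart h₀.isSelfAdjoint,
    etr_add (CFC.posPart_nonneg T) (CFC.negPart_nonneg T)] at h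
  have hp := CFC.posPart_nonneg T
  have hn := CFC.negPart_nonneg T
  have mp : T⁺ ∈ TC X := mem_TC_of_etr hp
    (ne_top_of_le_ne_top ENNReal.ofReal_ne_top (le_self_add.trans h))
  have mn : T⁻ ∈ TC X := mem_TC_of_etr hn
    (ne_top_of_le_ne_top ENNReal.ofReal_ne_top (le_add_self.trans h))
  refine ⟨⟨_, mp⟩, ⟨_, mn⟩, hp, hn, (CFC.posPart_sub_negPart T h₀.isSelfAdjoint).symm, ?_⟩
  rw [etr_eq mp hp, etr_eq mn hn, ← ENNReal.ofReal_add (tr_nonneg mp hp) (tr_nonneg mn hn)] at h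
  exact (ENNReal.ofReal_le_ofReal_iff hc).1 h

theorem HermLE.mono {X : Type} {T : Op X} {c c' : ℝ} (h : HermLE T c) (hc : c ≤ c') :
    HermLE T c' := by
  obtain ⟨A, B, hA, hB, hT, h⟩ := h
  exact ⟨A, B, hA, hB, hT, h.trans hc⟩

theorem HermLE.neg {X : Type} {T : Op X} {c : ℝ} (h : HermLE T c) : HermLE (-T) c := by
  obtain ⟨A, B, hA, hB, rfl, h⟩ := h
  exact ⟨B, A, hB, hA, neg_sub _ _, by linarith⟩

theorem HermLE.add {X : Type} {S T : Op X} {c d : ℝ} (hS : HermLE S c) (hT : HermLE T d) :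
    HermLE (S + T) (c + d) := by
  obtain ⟨A, B, hA, hB, rfl, h⟩ := hS
  obtain ⟨A', B', hA', hB', rfl, h'⟩ := hT
  refine ⟨A + A', B + B', add_nonneg hA hA', add_nonneg hB hB', ?_, ?_⟩
  · rw [Submodule.coe_add, Submodule.coe_add]; abel
  · rw [tr_add, tr_add, Complex.add_re, Complex.add_re]; linarith

theorem HermLE.smul {X : Type} {T : Op X} {c r : ℝ} (hT : HermLE T c) (hr : 0 ≤ r) :
    HermLE ((r : ℂ) • T) (r * c) := by
  obtain ⟨A, B, hA, hB, rfl, h⟩ := hT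
  refine ⟨(r : ℂ) • A, (r : ℂ) • B, smul_op_nonneg hA hr, smul_op_nonneg hB hr, ?_, ?_⟩
  · rw [smul_sub]; rfl
  · rw [Submodule.coe_smul, Submodule.coe_smul, tr_smul, tr_smul, Complex.re_ofReal_mul,
      Complex.re_ofReal_mul, ← mul_add]
    exact mul_le_mul_of_nonneg_left h hr

theorem HermLE.zero {X : Type} : HermLE (0 : Op X) 0 :=
  ⟨0, 0, le_rfl, le_rfl, by simp, by simp [tr]⟩

theorem HermLE.sum {X : Type} {ι : Type*} (s : Finset ι) {T : ι → Op X} {c : ι → ℝ}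
    (h : ∀ i ∈ s, HermLE (T i) (c i)) : HermLE (∑ i ∈ s, T i) (∑ i ∈ s, c i) := by
  classical
  induction s using Finset.induction_on with
  | empty => simpa using HermLE.zero
  | insert i s hi ih =>
    rw [Finset.sum_insert hi, Finset.sum_insert hi]
    exact (h i (Finset.mem_insert_self _ _)).add
      (ih fun j hj => h j (Finset.mem_insert_of_mem hj))

theorem HermLE.sub_of_nonneg {X : Type} {A B : TC X} (hA : 0 ≤ (A : Op X))
    (hB : 0 ≤ (B : Op X)) :
    HermLE ((A : Op X) - (B : Op X)) ((tr (A : Op X)).re + (tr (B : Op X)).re) :=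
  ⟨A, B, hA, hB, rfl, le_rfl⟩

/-- A positive trace-non-increasing map does not increase the trace norm. -/
theorem HermLE.map {X Y : Type} (F : TC X →ₗ[ℂ] TC Y)
    (hF : ∀ ρ : TC X, 0 ≤ (ρ : Op X) → 0 ≤ (F ρ : Op Y))
    (hF' : ∀ ρ : TC X, 0 ≤ (ρ : Op X) → (tr (F ρ : Op Y)).re ≤ (tr (ρ : Op X)).re)
    {T : TC X} {c : ℝ} (h : HermLE (T : Op X) c) : HermLE (F T : Op Y) c := by
  obtain ⟨A, B, hA, hB, hT, h⟩ := h
  have : T = A - B := Subtype.ext hT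
  subst this
  exact ⟨F A, F B, hF A hA, hF B hB, by rw [map_sub, Submodule.coe_sub],
    (add_le_add (hF' A hA) (hF' B hB)).trans h⟩

/-! ### Weak limits -/

/-- Convergence in the weak operator topology. -/
def WLim {X : Type} {ι : Type*} (l : Filter ι) (T : ι → Op X) (S : Op X) : Prop :=
  ∀ f g, Tendsto (fun i => ⟪f, T i g⟫_ℂ) l (𝓝 ⟪f, S g⟫_ℂ)

theorem WLim.unique {X : Type} {ι : Type*} {l : Filter ι} [l.NeBot] {T : ι → Op X} {S S' : Op X}
    (h : WLim l T S) (h' : WLim l T S') : S = S' :=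
  op_ext fun y x => tendsto_nhds_unique (h (ket y) (ket x)) (h' (ket y) (ket x))

theorem WLim.add {X : Type} {ι : Type*} {l : Filter ι} {T T' : ι → Op X} {S S' : Op X}
    (h : WLim l T S) (h' : WLim l T' S') : WLim l (fun i => T i + T' i) (S + S') := fun f g => by
  simpa [inner_add_right] using (h f g).add (h' f g)

theorem WLim.smul {X : Type} {ι : Type*} {l : Filter ι} {T : ι → Op X} {S : Op X} (c : ℂ)
    (h : WLim l T S) : WLim l (fun i => c • T i) (c • S) := fun f g => by
  simpa [inner_smul_right] using (h f g).const_mul c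

theorem WLim.sub {X : Type} {ι : Type*} {l : Filter ι} {T T' : ι → Op X} {S S' : Op X}
    (h : WLim l T S) (h' : WLim l T' S') : WLim l (fun i => T i - T' i) (S - S') := fun f g => by
  simpa [inner_sub_right] using (h f g).sub (h' f g)

theorem WLim.conj {X Y : Type} {ι : Type*} {l : Filter ι} {T : ι → Op X} {S : Op X}
    (h : WLim l T S) (V W : Ell2 X →L[ℂ] Ell2 Y) :
    WLim l (fun i => V ∘L T i ∘L W.adjoint) (V ∘L S ∘L W.adjoint) := fun f g => by
  simpa [← adjoint_inner_left V] using h (V.adjoint f) (W.adjoint g)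

/-- Bounded sets of operators are compact in the weak operator topology. -/
theorem exists_wlim {X : Type} {ι : Type*} (U : Ultrafilter ι) (T : ι → Op X) (c : ℝ)
    (h : ∀ i, ‖T i‖ ≤ c) : ∃ S, WLim (U : Filter ι) T S := by
  have hb : ∀ i (f g : Ell2 X), ‖⟪T i f, g⟫_ℂ‖ ≤ c * ‖f‖ * ‖g‖ := fun i f g =>
    (norm_inner_le_norm _ _).trans (mul_le_mul_of_nonneg_right
      (((T i).le_opNorm f).trans (mul_le_mul_of_nonneg_right (h i) (norm_nonneg _)))
      (norm_nonneg _))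
  have hex : ∀ f g : Ell2 X, ∃ z, Tendsto (fun i => ⟪T i f, g⟫_ℂ) U (𝓝 z) := by
    intro f g
    obtain ⟨z, -, hz⟩ := (isCompact_closedBall (0 : ℂ) (c * ‖f‖ * ‖g‖)).ultrafilter_le_nhds
      (U.map fun i => ⟪T i f, g⟫_ℂ) (by
        rw [le_principal_iff]
        exact Eventually.of_forall (f := (U : Filter ι)) fun i => by simpa using hb i f g)
    exact ⟨z, hz⟩
  choose L hL using hex
  have hLb : ∀ f g, ‖L f g‖ ≤ c * ‖f‖ * ‖g‖ := fun f g =>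
    le_of_tendsto (hL f g).norm (Eventually.of_forall fun i => hb i f g)
  -- The limits form a bounded sesquilinear form, which is represented by an operator.
  let Bl : Ell2 X →ₗ⋆[ℂ] Ell2 X →ₗ[ℂ] ℂ := LinearMap.mk₂'ₛₗ (starRingEnd ℂ) (RingHom.id ℂ) L
    (fun f f' g => tendsto_nhds_unique (hL _ _) (by
      simpa [inner_add_left] using (hL f g).add (hL f' g)))
    (fun r f g => tendsto_nhds_unique (hL _ _) (by
      simpa [inner_smul_left, mul_comm] using (hL f g).const_mul (starRingEnd ℂ r)))
    (fun f g g' => tendsto_nhds_unique (hL _ _) (by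
      simpa [inner_add_right] using (hL f g).add (hL f g')))
    (fun r f g => tendsto_nhds_unique (hL _ _) (by
      simpa [inner_smul_right] using (hL f g).const_mul r))
  let Bc : Ell2 X →L⋆[ℂ] Ell2 X →L[ℂ] ℂ := Bl.mkContinuous₂ c hLb
  refine ⟨InnerProductSpace.continuousLinearMapOfBilin Bc, fun f g => ?_⟩
  have h1 : ⟪InnerProductSpace.continuousLinearMapOfBilin Bc g, f⟫_ℂ = L g f :=
    InnerProductSpace.continuousLinearMapOfBilin_apply Bc g f
  have h2 := (Complex.continuous_conj.tendsto _).comp (hL g f)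
  rw [← inner_conj_symm, h1]
  refine h2.congr fun i => ?_
  exact inner_conj_symm _ _

theorem WLim.nonneg {X : Type} {ι : Type*} {l : Filter ι} [l.NeBot] {T : ι → Op X} {S : Op X}
    (h : WLim l T S) (h0 : ∀ i, 0 ≤ T i) : 0 ≤ S :=
  nonneg_of_inner
    (fun f => ge_of_tendsto' ((Complex.continuous_re.tendsto _).comp (h f f))
      fun i => re_inner_nonneg (h0 i) f)
    (fun f => tendsto_nhds_unique ((Complex.continuous_im.tendsto _).comp (h f f)) (by
      refine tendsto_const_nhds.congr fun i => ?_
      exact (im_inner_eq_zero (h0 i) f).symm))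

/-- The trace is lower semicontinuous on positive operators. -/
theorem WLim.etr_le {X : Type} {ι : Type*} {l : Filter ι} [l.NeBot] {T : ι → TC X} {S : Op X}
    {c : ℝ} (h : WLim l (fun i => (T i : Op X)) S) (h0 : ∀ i, 0 ≤ (T i : Op X))
    (hc : ∀ i, (tr (T i : Op X)).re ≤ c) : etr S ≤ ENNReal.ofReal c := by
  have hS := h.nonneg h0
  unfold etr
  rw [ENNReal.tsum_eq_iSup_sum]
  refine iSup_le fun s => ?_
  rw [← ENNReal.ofReal_sum_of_nonneg fun x _ => re_inner_nonneg hS _]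
  refine ENNReal.ofReal_le_ofReal ?_
  refine le_of_tendsto' (tendsto_finsetSum s fun x _ =>
    (Complex.continuous_re.tendsto _).comp (h (ket x) (ket x))) fun i => ?_
  refine le_trans ?_ (hc i)
  rw [tr_re (T i).2]
  exact (Complex.hasSum_re (TC.summable (T i).2).hasSum).summable.sum_le_tsum s
    fun x _ => re_inner_nonneg (h0 i) _

/-- Bounded sets of positive trace-class operators are compact in the weak operator topology. -/
theorem exists_wlim_nonneg {X : Type} {ι : Type*} (U : Ultrafilter ι) (T : ι → TC X) (c : ℝ)
    (h0 : ∀ i, 0 ≤ (T i : Op X)) (hc : ∀ i, (tr (T i : Op X)).re ≤ c) :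
    ∃ S : TC X, 0 ≤ (S : Op X) ∧ (tr (S : Op X)).re ≤ c ∧
      WLim (U : Filter ι) (fun i => (T i : Op X)) S := by
  obtain ⟨S, hS⟩ := exists_wlim U (fun i => (T i : Op X)) c
    fun i => (norm_le_tr (T i).2 (h0 i)).trans (hc i)
  have h1 := hS.nonneg h0
  have h2 := hS.etr_le h0 hc
  have h3 := mem_TC_of_etr h1 (ne_top_of_le_ne_top ENNReal.ofReal_ne_top h2)
  refine ⟨⟨S, h3⟩, h1, ?_, hS⟩
  have : Nonempty ι := U.nonempty_of_mem univ_mem |>.nonempty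
  have hc0 : 0 ≤ c := (tr_nonneg (T (Classical.arbitrary ι)).2 (h0 _)).trans (hc _)
  rw [etr_eq h3 h1] at h2
  exact (ENNReal.ofReal_le_ofReal_iff hc0).1 h2

/-- The trace norm is lower semicontinuous in the weak operator topology. -/
theorem HermLE.wlim {X : Type} {ι : Type*} (U : Ultrafilter ι) {T : ι → Op X} {S : Op X} {c : ℝ}
    (h : ∀ i, HermLE (T i) c) (hS : WLim (U : Filter ι) T S) : HermLE S c := by
  choose A B hA hB hT hc using h
  obtain ⟨A', hA', -, hAl⟩ := exists_wlim_nonneg U A c hA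
    fun i => (le_add_of_nonneg_right (tr_nonneg (B i).2 (hB i))).trans (hc i)
  obtain ⟨B', hB', -, hBl⟩ := exists_wlim_nonneg U B c hB
    fun i => (le_add_of_nonneg_left (tr_nonneg (A i).2 (hA i))).trans (hc i)
  refine ⟨A', B', hA', hB', hS.unique ?_, ?_⟩
  · rw [funext hT]
    exact hAl.sub hBl
  · have : Nonempty ι := U.nonempty_of_mem univ_mem |>.nonempty
    have hc0 : 0 ≤ c := (add_nonneg (tr_nonneg (A (Classical.arbitrary ι)).2 (hA _))
      (tr_nonneg (B _).2 (hB _))).trans (hc _)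
    -- Bounding the limit of the sums gives more than bounding the two limits separately.
    have h1 : etr ((A' + B' : TC X) : Op X) ≤ ENNReal.ofReal c :=
      WLim.etr_le (T := fun i => A i + B i) (hAl.add hBl) (fun i => add_nonneg (hA i) (hB i))
        fun i => by rw [tr_add, Complex.add_re]; exact hc i
    rw [etr_eq (A' + B').2 (add_nonneg hA' hB'), tr_add, Complex.add_re] at h1
    exact (ENNReal.ofReal_le_ofReal_iff hc0).1 h1

/-! ### Slices, blocks and tensor products of operators -/

theorem inner_ket_slice {X K Z : Type} (e : X × K ≃ Z) (k : K) (x : X) (f : Ell2 Z) :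
    ⟪ket x, slice e k f⟫_ℂ = ⟪ket (e (x, k)), f⟫_ℂ := by
  rw [Ell2.inner_ket, Ell2.inner_ket]
  rfl

theorem slice_adjoint_ket {X K Z : Type} (e : X × K ≃ Z) (k : K) (x : X) :
    (slice e k).adjoint (ket x) = ket (e (x, k)) := by
  refine vec_ext fun z => ?_
  rw [adjoint_inner_right, ← inner_conj_symm, inner_ket_slice, inner_conj_symm]

theorem slice_ext {X K Y Z : Type} (e : X × K ≃ Z) {S T : Ell2 Y →L[ℂ] Ell2 Z}
    (h : ∀ k, slice e k ∘L S = slice e k ∘L T) : S = T := by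
  refine op_ext fun z y => ?_
  obtain ⟨⟨x, k⟩, rfl⟩ := e.surjective z
  rw [← inner_ket_slice, ← inner_ket_slice]
  exact congrArg (fun A : Ell2 Y →L[ℂ] Ell2 X => ⟪ket x, A (ket y)⟫_ℂ) (h k)

theorem slice_comp_adjoint_self {X K Z : Type} (e : X × K ≃ Z) (k : K) :
    slice e k ∘L (slice e k).adjoint = 1 := by
  refine op_ext fun y x => ?_
  rw [comp_apply, slice_adjoint_ket, inner_ket_slice]
  by_cases h : y = x
  · subst h
    rw [inner_ket_self]
    exact (inner_ket_self y).symm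
  · have h1 : (ket (e (x, k))).coord (e (y, k)) = 0 :=
      coord_ket_of_ne fun h' => h (by simpa using h')
    rw [Ell2.inner_ket, h1]
    change 0 = ⟪ket y, ket x⟫_ℂ
    rw [Ell2.inner_ket, coord_ket_of_ne h]

theorem slice_comp_adjoint_of_ne {X K Z : Type} (e : X × K ≃ Z) {k l : K} (h : k ≠ l) :
    slice e k ∘L (slice e l).adjoint = 0 := by
  refine op_ext fun y x => ?_
  rw [comp_apply, slice_adjoint_ket, inner_ket_slice, Ell2.inner_ket,
    coord_ket_of_ne fun h' => h (by simpa using congrArg Prod.snd (e.injective h'))]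
  simp

theorem slice_comp_tensorOp {X K Z : Type} (e : X × K ≃ Z) (k : K) (A : Op X) :
    slice e k ∘L tensorOp e A = A ∘L slice e k := by
  ext1 f
  refine vec_ext fun x => ?_
  rw [comp_apply, inner_ket_slice, Ell2.inner_ket, Ell2.inner_ket]
  change (A (slice e (e.symm (e (x, k))).2 f)).coord (e.symm (e (x, k))).1 = _
  rw [Equiv.symm_apply_apply]
  rfl

theorem tensorOp_mul {X K Z : Type} (e : X × K ≃ Z) (A B : Op X) :
    tensorOp e (A * B) = tensorOp e A * tensorOp e B :=
  slice_ext e fun k => by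
    rw [slice_comp_tensorOp]
    change _ = slice e k ∘L (tensorOp e A ∘L tensorOp e B)
    rw [← comp_assoc, slice_comp_tensorOp, comp_assoc, slice_comp_tensorOp]
    rfl

theorem tensorOp_one {X K Z : Type} (e : X × K ≃ Z) : tensorOp e (1 : Op X) = 1 :=
  slice_ext e fun k => by
    rw [slice_comp_tensorOp]
    rfl

theorem tensorOp_add {X K Z : Type} (e : X × K ≃ Z) (A B : Op X) :
    tensorOp e (A + B) = tensorOp e A + tensorOp e B :=
  slice_ext e fun k => by
    rw [slice_comp_tensorOp, comp_add, slice_comp_tensorOp, slice_comp_tensorOp, add_comp]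

theorem tensorOp_sub {X K Z : Type} (e : X × K ≃ Z) (A B : Op X) :
    tensorOp e (A - B) = tensorOp e A - tensorOp e B :=
  slice_ext e fun k => by
    rw [slice_comp_tensorOp, comp_sub, slice_comp_tensorOp, slice_comp_tensorOp, sub_comp]

theorem tensorOp_smul {X K Z : Type} (e : X × K ≃ Z) (c : ℂ) (A : Op X) :
    tensorOp e (c • A) = c • tensorOp e A :=
  slice_ext e fun k => by
    rw [slice_comp_tensorOp, comp_smul, slice_comp_tensorOp, smul_comp]

theorem tensorOp_sum {X K Z : Type} (e : X × K ≃ Z) {ι : Type*} (s : Finset ι) (A : ι → Op X) :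
    tensorOp e (∑ i ∈ s, A i) = ∑ i ∈ s, tensorOp e (A i) :=
  map_sum ({ toFun := tensorOp e, map_zero' := by
              simpa using tensorOp_smul e 0 0
             map_add' := tensorOp_add e } : Op X →+ Op Z) A s

theorem tensorOp_comp_slice_adjoint {X K Z : Type} (e : X × K ≃ Z) (k : K) (A : Op X) :
    tensorOp e A ∘L (slice e k).adjoint = (slice e k).adjoint ∘L A :=
  slice_ext e fun l => by
    rw [← comp_assoc, slice_comp_tensorOp, comp_assoc, ← comp_assoc (slice e l)]
    by_cases h : l = k
    · subst h
      rw [slice_comp_adjoint_self]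
      rfl
    · rw [slice_comp_adjoint_of_ne e h, comp_zero, zero_comp]

theorem tensorOp_star {X K Z : Type} (e : X × K ≃ Z) (A : Op X) :
    tensorOp e (star A) = star (tensorOp e A) :=
  slice_ext e fun k => by
    have h := congrArg ContinuousLinearMap.adjoint (tensorOp_comp_slice_adjoint e k A)
    rw [adjoint_comp, adjoint_comp, adjoint_adjoint] at h
    rw [slice_comp_tensorOp]
    exact h.symm

theorem tensorOp_nonneg {X K Z : Type} (e : X × K ≃ Z) {A : Op X} (hA : 0 ≤ A) :
    0 ≤ tensorOp e A := by
  have h : A = star (CFC.sqrt A) * CFC.sqrt A := by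
    rw [(CFC.sqrt_nonneg A).isSelfAdjoint.star_eq, CFC.sqrt_mul_sqrt_self A hA]
  rw [h, tensorOp_mul, tensorOp_star]
  exact star_mul_self_nonneg _

theorem tensorOp_mono {X K Z : Type} (e : X × K ≃ Z) {A B : Op X} (h : A ≤ B) :
    tensorOp e A ≤ tensorOp e B := by
  rw [← sub_nonneg, ← tensorOp_sub]
  exact tensorOp_nonneg e (sub_nonneg.2 h)

theorem sum_slice_tensorOp {X K Z : Type} (e : X × K ≃ Z) (A : Op X) (f : Ell2 Z) :
    ENNReal.ofReal (‖tensorOp e A f‖ ^ 2)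
      = ∑' k, ENNReal.ofReal (‖A (slice e k f)‖ ^ 2) := by
  rw [← sum_slice e]
  refine tsum_congr fun k => ?_
  rw [← comp_apply (slice e k), slice_comp_tensorOp]
  rfl

theorem inner_block {X K Z : Type} (e : X × K ≃ Z) (k l : K) (T : TC Z) (x y : X) :
    ⟪ket x, (block e k l T : Op X) (ket y)⟫_ℂ
      = ⟪ket (e (x, k)), (T : Op Z) (ket (e (y, l)))⟫_ℂ := by
  rw [← slice_adjoint_ket e l, ← inner_ket_slice]
  rfl

theorem block_ext {X K Z : Type} (e : X × K ≃ Z) {S T : TC Z}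
    (h : ∀ k l, block e k l S = block e k l T) : S = T := by
  refine Subtype.ext (op_ext fun z w => ?_)
  obtain ⟨⟨x, k⟩, rfl⟩ := e.surjective z
  obtain ⟨⟨y, l⟩, rfl⟩ := e.surjective w
  rw [← inner_block, ← inner_block, h]

theorem block_self_nonneg {X K Z : Type} (e : X × K ≃ Z) (k : K) {T : TC Z}
    (hT : 0 ≤ (T : Op Z)) : 0 ≤ (block e k k T : Op X) := conj_nonneg hT _

theorem block_sandwich_tensorOp {X K Z : Type} (e : X × K ≃ Z) (k l : K) (A B : Op X) (T : TC Z) :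
    block e k l (sandwich (tensorOp e A) (tensorOp e B) T) = sandwich A B (block e k l T) := by
  refine Subtype.ext ?_
  change slice e k ∘L (tensorOp e A ∘L (T : Op Z) ∘L (tensorOp e B).adjoint)
      ∘L (slice e l).adjoint
    = A ∘L (slice e k ∘L (T : Op Z) ∘L (slice e l).adjoint) ∘L B.adjoint
  have h := congrArg ContinuousLinearMap.adjoint (slice_comp_tensorOp e l B)
  rw [adjoint_comp, adjoint_comp] at h
  have h' := slice_comp_tensorOp e k A
  calc _ = (slice e k ∘L tensorOp e A) ∘L (T : Op Z)
        ∘L ((tensorOp e B).adjoint ∘L (slice e l).adjoint) := rfl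
    _ = _ := by rw [h, h']; rfl

theorem block_conj_tensorOp {X K Z : Type} (e : X × K ≃ Z) (k l : K) (A : Op X) (T : TC Z) :
    block e k l (conj (tensorOp e A) T) = conj A (block e k l T) :=
  block_sandwich_tensorOp e k l A A T

/-! ### Partial traces -/

/-- The trace of `T` is the trace of its partial trace, the sum of its diagonal blocks. -/
theorem hasSum_tr_block {X K Z : Type} (e : X × K ≃ Z) (T : TC Z) :
    HasSum (fun k => tr (block e k k T : Op X)) (tr (T : Op Z)) := by
  have h := TC.summable T.2
  have h1 : HasSum (fun p : K × X => ⟪ket (e (p.2, p.1)), (T : Op Z) (ket (e (p.2, p.1)))⟫_ℂ)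
      (tr (T : Op Z)) :=
    (Equiv.hasSum_iff ((Equiv.prodComm K X).trans e)).2 h.hasSum
  have h2 := h1.prod_fiberwise (g := fun k => tr (block e k k T : Op X)) fun k => by
    have h3 := (TC.summable (block e k k T).2).hasSum
    simp_rw [inner_block] at h3
    unfold tr
    simp_rw [inner_block]
    exact h3
  exact h2

theorem hasSum_re_tr_block {X K Z : Type} (e : X × K ≃ Z) (T : TC Z) :
    HasSum (fun k => (tr (block e k k T : Op X)).re) (tr (T : Op Z)).re :=
  Complex.hasSum_re (hasSum_tr_block e T)

/-- The map `T ↦ A T`. -/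
def mulTC {X : Type} (A : Op X) : TC X →ₗ[ℂ] TC X := sandwich A 1

theorem coe_mulTC {X : Type} (A : Op X) (T : TC X) :
    (mulTC A T : Op X) = A * (T : Op X) := by
  change A ∘L (T : Op X) ∘L adjoint (1 : Op X) = A * (T : Op X)
  rw [show adjoint (1 : Op X) = 1 from star_one (Op X)]
  rfl

theorem tr_mul_add_left {X : Type} (A B : Op X) (T : TC X) :
    tr ((A + B) * (T : Op X)) = tr (A * (T : Op X)) + tr (B * (T : Op X)) := by
  rw [add_mul, ← coe_mulTC, ← coe_mulTC, ← tr_add]; rfl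

theorem tr_mul_sub_left {X : Type} (A B : Op X) (T : TC X) :
    tr ((A - B) * (T : Op X)) = tr (A * (T : Op X)) - tr (B * (T : Op X)) := by
  rw [eq_sub_iff_add_eq, ← tr_mul_add_left, sub_add_cancel]

theorem tr_mul_smul_left {X : Type} (c : ℂ) (A : Op X) (T : TC X) :
    tr ((c • A) * (T : Op X)) = c * tr (A * (T : Op X)) := by
  rw [smul_mul_assoc, tr_smul]

theorem tr_mul_sum_left {X : Type} {ι : Type*} (s : Finset ι) (A : ι → Op X) (T : TC X) :
    tr ((∑ i ∈ s, A i) * (T : Op X)) = ∑ i ∈ s, tr (A i * (T : Op X)) := by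
  classical
  induction s using Finset.induction_on with
  | empty => simp [tr]
  | insert i s hi ih => rw [Finset.sum_insert hi, Finset.sum_insert hi, tr_mul_add_left, ih]

theorem coe_conj_nonneg {Z : Type} (M : Op Z) {ρ : TC Z} (hρ : 0 ≤ (ρ : Op Z)) :
    0 ≤ (conj M ρ : Op Z) := conj_nonneg hρ M

theorem tr_conj {X : Type} (V : Op X) (T : TC X) :
    tr (conj V T : Op X) = tr (star V * V * (T : Op X)) :=
  tr_sandwich V V T.2

theorem tr_mul_conj {X : Type} (A V : Op X) (T : TC X) :
    tr (A * (conj V T : Op X)) = tr (star V * A * V * (T : Op X)) :=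
  tr_sandwich (A * V) V T.2

theorem tr_mul_nonneg {X : Type} {A : Op X} (hA : 0 ≤ A) {T : TC X} (hT : 0 ≤ (T : Op X)) :
    0 ≤ (tr (A * (T : Op X))).re := by
  have h : A = star (CFC.sqrt A) * CFC.sqrt A := by
    rw [(CFC.sqrt_nonneg A).isSelfAdjoint.star_eq, CFC.sqrt_mul_sqrt_self A hA]
  rw [h, ← tr_conj]
  exact tr_nonneg (conj _ T).2 (conj_nonneg hT _)

theorem tr_mul_mono {X : Type} {A B : Op X} (h : A ≤ B) {T : TC X} (hT : 0 ≤ (T : Op X)) :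
    (tr (A * (T : Op X))).re ≤ (tr (B * (T : Op X))).re := by
  have := tr_mul_nonneg (sub_nonneg.2 h) hT
  rw [tr_mul_sub_left, Complex.sub_re] at this
  linarith

theorem tr_mul_le {X : Type} {A : Op X} (h : A ≤ 1) {T : TC X} (hT : 0 ≤ (T : Op X)) :
    (tr (A * (T : Op X))).re ≤ (tr (T : Op X)).re := by
  simpa using tr_mul_mono h hT

theorem hasSum_re_tr_mul_block {X K Z : Type} (e : X × K ≃ Z) (A : Op X) (T : TC Z) :
    HasSum (fun k => (tr (A * (block e k k T : Op X))).re) (tr (tensorOp e A * (T : Op Z))).re := by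
  have h := hasSum_re_tr_block e (sandwich (tensorOp e A) (tensorOp e 1) T)
  simp_rw [block_sandwich_tensorOp, tensorOp_one] at h
  simp_rw [← coe_mulTC]
  exact h

/-! ### Constructing maps on the trace class -/

theorem TC.induction {X : Type} {p : TC X → Prop} (nonneg : ∀ ρ : TC X, 0 ≤ (ρ : Op X) → p ρ)
    (add : ∀ A B, p A → p B → p (A + B)) (smul : ∀ (c : ℂ) A, p A → p (c • A)) (T : TC X) :
    p T := by
  obtain ⟨T, hT⟩ := T
  have hT' := hT
  unfold TC at hT'
  induction hT' using Submodule.span_induction with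
  | mem ρ h => exact nonneg ⟨ρ, _⟩ h.1
  | zero => exact nonneg ⟨0, _⟩ le_rfl
  | add A B ha hb hA hB => exact add ⟨A, ha⟩ ⟨B, hb⟩ (hA ha) (hB hb)
  | smul c A ha hA => exact smul c ⟨A, ha⟩ (hA ha)

/-- Two linear maps on the trace class that agree on positive operators are equal. -/
theorem superMap_ext {X Y : Type} {E F : TC X →ₗ[ℂ] TC Y}
    (h : ∀ ρ : TC X, 0 ≤ (ρ : Op X) → E ρ = F ρ) : E = F :=
  LinearMap.ext fun T => TC.induction (p := fun T => E T = F T) h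
    (fun A B hA hB => by rw [map_add, map_add, hA, hB])
    (fun c A hA => by rw [map_smul, map_smul, hA]) T

/-- A linear, functional relation `R` that is solvable on positive operators defines a linear map:
positive operators span the trace class. -/
theorem exists_linearMap {X Y : Type} (R : TC X → TC Y → Prop)
    (hadd : ∀ {A B S T}, R A S → R B T → R (A + B) (S + T))
    (hsmul : ∀ (c : ℂ) {A S}, R A S → R (c • A) (c • S))
    (huniq : ∀ {A S T}, R A S → R A T → S = T)
    (hex : ∀ ρ : TC X, 0 ≤ (ρ : Op X) → ∃ S, R ρ S) : ∃ F : TC X →ₗ[ℂ] TC Y, ∀ T, R T (F T) := by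
  have h : ∀ T, ∃ S, R T S := TC.induction hex
    (fun A B ⟨S, hS⟩ ⟨T, hT⟩ => ⟨S + T, hadd hS hT⟩) fun c A ⟨S, hS⟩ => ⟨c • S, hsmul c hS⟩
  choose F hF using h
  exact ⟨{ toFun := F
           map_add' := fun A B => huniq (hF _) (hadd (hF A) (hF B))
           map_smul' := fun c A => huniq (hF _) (hsmul c (hF A)) }, hF⟩

theorem theMap_spec {X : Type} {p : SuperMap X → Prop} (h : ∃ F, p F) : p (theMap p) := by
  unfold theMap
  rw [dif_pos h]
  exact h.choose_spec

/-! ### Completely positive maps -/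

/-- Complete positivity with respect to arbitrary auxiliary spaces: for every decomposition of
`ℓ²(Z)` as `ℓ²(X) ⊗ ℓ²(K)` the map `E ⊗ I` exists and is positive. -/
def CP {X : Type} (E : SuperMap X) : Prop :=
  ∀ (K Z : Type) (e : X × K ≃ Z), ∃ F : SuperMap Z,
    (∀ T k l, block e k l (F T) = E (block e k l T)) ∧
      ∀ T : TC Z, 0 ≤ (T : Op Z) → 0 ≤ (F T : Op Z)

/-- The map does not increase the trace of positive operators. -/
def TNI {X : Type} (E : SuperMap X) : Prop :=
  ∀ T : TC X, 0 ≤ (T : Op X) → (tr (E T : Op X)).re ≤ (tr (T : Op X)).re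

section CP
variable {X K Z : Type} {E E' : SuperMap X}

theorem CP.block_tensorId (h : CP E) (e : X × K ≃ Z) (T : TC Z) (k l : K) :
    block e k l (tensorId e E T) = E (block e k l T) := by
  obtain ⟨F, hF, -⟩ := h K Z e
  exact theMap_spec (p := fun F : SuperMap Z =>
    ∀ (T : TC Z) (k l : K), block e k l (F T) = E (block e k l T)) ⟨F, hF⟩ T k l

theorem CP.tensorId_eq (h : CP E) (e : X × K ≃ Z) {F : SuperMap Z}
    (hF : ∀ T k l, block e k l (F T) = E (block e k l T)) : tensorId e E = F :=
  LinearMap.ext fun T => block_ext e fun k l => by rw [h.block_tensorId, hF]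

theorem CP.tensorId_nonneg (h : CP E) (e : X × K ≃ Z) {T : TC Z} (hT : 0 ≤ (T : Op Z)) :
    0 ≤ (tensorId e E T : Op Z) := by
  obtain ⟨F, hF, hF'⟩ := h K Z e
  rw [h.tensorId_eq e hF]
  exact hF' T hT

/-- A completely positive map is positive, as one sees from a one-dimensional auxiliary space. -/
theorem CP.nonneg (h : CP E) {T : TC X} (hT : 0 ≤ (T : Op X)) : 0 ≤ (E T : Op X) := by
  let e : X × Unit ≃ X := Equiv.prodPUnit X
  have h1 : slice e () ∘L (slice e ()).adjoint = 1 := slice_comp_adjoint_self e ()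
  have h2 : block e () () (sandwich (slice e ()).adjoint (slice e ()).adjoint T) = T := by
    refine Subtype.ext ?_
    change slice e () ∘L ((slice e ()).adjoint ∘L (T : Op X) ∘L (slice e ()).adjoint.adjoint)
      ∘L (slice e ()).adjoint = T
    rw [adjoint_adjoint]
    calc _ = (slice e () ∘L (slice e ()).adjoint) ∘L (T : Op X)
          ∘L (slice e () ∘L (slice e ()).adjoint) := rfl
      _ = _ := by rw [h1]; rfl
  rw [← h2, ← h.block_tensorId e]
  exact block_self_nonneg e () (h.tensorId_nonneg e (conj_nonneg hT _))

theorem TNI.tensorId (h' : TNI E) (h : CP E) (e : X × K ≃ Z) : TNI (tensorId e E) := by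
  intro T hT
  refine hasSum_le (fun k => ?_) (hasSum_re_tr_block e _) (hasSum_re_tr_block e T)
  rw [h.block_tensorId]
  exact h' _ (block_self_nonneg e k hT)

/-- It suffices to apply `E ⊗ I` to positive operators. -/
theorem CP.of_exists (h : ∀ {K Z : Type} (e : X × K ≃ Z) (T : TC Z), 0 ≤ (T : Op Z) →
    ∃ S : TC Z, 0 ≤ (S : Op Z) ∧ ∀ k l, block e k l S = E (block e k l T)) : CP E := by
  intro K Z e
  obtain ⟨F, hF⟩ := exists_linearMap (X := Z) (Y := Z)
    (fun T S => ∀ k l, block e k l S = E (block e k l T))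
    (fun h1 h2 k l => by rw [map_add, map_add, map_add, h1, h2])
    (fun c _ _ h1 k l => by rw [map_smul, map_smul, map_smul, h1])
    (fun h1 h2 => block_ext e fun k l => by rw [h1, h2])
    (fun ρ hρ => (h e ρ hρ).imp fun _ hS => hS.2)
  refine ⟨F, hF, fun T hT => ?_⟩
  obtain ⟨S, hS, hS'⟩ := h e T hT
  rwa [block_ext e (S := F T) (T := S) fun k l => by rw [hF, hS']]

theorem CP.zero : CP (0 : SuperMap X) :=
  CP.of_exists fun _ _ _ => ⟨0, le_rfl, fun _ _ => by simp⟩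

theorem CP.id : CP (LinearMap.id : SuperMap X) :=
  CP.of_exists fun _ T hT => ⟨T, hT, fun _ _ => rfl⟩

theorem CP.add (h : CP E) (h' : CP E') : CP (E + E') :=
  CP.of_exists fun e T hT => ⟨tensorId e E T + tensorId e E' T,
    add_nonneg (h.tensorId_nonneg e hT) (h'.tensorId_nonneg e hT), fun k l => by
      rw [map_add, h.block_tensorId, h'.block_tensorId]; rfl⟩

theorem CP.sum {ι : Type*} (s : Finset ι) {E : ι → SuperMap X} (h : ∀ i ∈ s, CP (E i)) :
    CP (∑ i ∈ s, E i) := by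
  classical
  induction s using Finset.induction_on with
  | empty => simpa using CP.zero
  | insert i s hi ih =>
    rw [Finset.sum_insert hi]
    exact (h i (Finset.mem_insert_self _ _)).add
      (ih fun j hj => h j (Finset.mem_insert_of_mem hj))

theorem CP.smul (h : CP E) {r : ℝ} (hr : 0 ≤ r) : CP ((r : ℂ) • E) :=
  CP.of_exists fun e T hT => ⟨(r : ℂ) • tensorId e E T,
    smul_op_nonneg (h.tensorId_nonneg e hT) hr, fun k l => by
      rw [map_smul, h.block_tensorId]; rfl⟩

theorem CP.comp (h : CP E) (h' : CP E') : CP (E ∘ₗ E') :=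
  CP.of_exists fun e T hT => ⟨tensorId e E (tensorId e E' T),
    h.tensorId_nonneg e (h'.tensorId_nonneg e hT), fun k l => by
      rw [h.block_tensorId, h'.block_tensorId]; rfl⟩

theorem CP.conj (V : Op X) : CP (conj V) :=
  CP.of_exists fun e T hT => ⟨QRobust.conj (tensorOp e V) T, conj_nonneg hT _,
    fun k l => block_conj_tensorOp e k l V T⟩

theorem tensorId_conj (e : X × K ≃ Z) (V : Op X) :
    tensorId e (QRobust.conj V) = QRobust.conj (tensorOp e V) :=
  (CP.conj V).tensorId_eq e fun T k l => block_conj_tensorOp e k l V T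

theorem CP.tensorId_add (h : CP E) (h' : CP E') (e : X × K ≃ Z) :
    QRobust.tensorId e (E + E') = QRobust.tensorId e E + QRobust.tensorId e E' :=
  (h.add h').tensorId_eq e fun T k l => by
    rw [LinearMap.add_apply, map_add, h.block_tensorId, h'.block_tensorId]; rfl

theorem CP.tensorId_smul (h : CP E) {r : ℝ} (hr : 0 ≤ r) (e : X × K ≃ Z) :
    QRobust.tensorId e ((r : ℂ) • E) = (r : ℂ) • QRobust.tensorId e E :=
  (h.smul hr).tensorId_eq e fun T k l => by
    rw [LinearMap.smul_apply, map_smul, h.block_tensorId]; rfl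

theorem CP.tensorId_comp (h : CP E) (h' : CP E') (e : X × K ≃ Z) :
    QRobust.tensorId e (E ∘ₗ E') = QRobust.tensorId e E ∘ₗ QRobust.tensorId e E' :=
  (h.comp h').tensorId_eq e fun T k l => by
    rw [LinearMap.comp_apply, h.block_tensorId, h'.block_tensorId]; rfl

theorem CP.tensorId_sum {ι : Type*} (s : Finset ι) {E : ι → SuperMap X} (h : ∀ i ∈ s, CP (E i))
    (e : X × K ≃ Z) :
    QRobust.tensorId e (∑ i ∈ s, E i) = ∑ i ∈ s, QRobust.tensorId e (E i) :=
  (CP.sum s h).tensorId_eq e fun T k l => by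
    rw [LinearMap.sum_apply, map_sum, LinearMap.sum_apply]
    exact Finset.sum_congr rfl fun i hi => (h i hi).block_tensorId e T k l

/-- Tensoring with an identity twice is tensoring with an identity once. -/
theorem CP.tensorId (h : CP E) (e : X × K ≃ Z) : CP (tensorId e E) :=
  CP.of_exists fun {K' Z'} e' T hT => by
    let e'' : X × (K × K') ≃ Z' :=
      (Equiv.prodAssoc X K K').symm.trans ((e.prodCongr (Equiv.refl K')).trans e')
    have hb : ∀ (S : TC Z') (k l : K) (k' l' : K'),
        block e k l (block e' k' l' S) = block e'' (k, k') (l, l') S := fun S k l k' l' =>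
      Subtype.ext <| op_ext fun x y => by
        rw [inner_block, inner_block, inner_block]; rfl
    refine ⟨QRobust.tensorId e'' E T, h.tensorId_nonneg e'' hT, fun k' l' => ?_⟩
    refine block_ext e fun k l => ?_
    rw [hb, h.block_tensorId, h.block_tensorId, hb]

/-- If the maps `E i` converge weakly to `F`, then `E i ⊗ I` converge weakly on positive operators,
and the blocks of the limit are those of `F ⊗ I`. -/
theorem exists_wlim_tensorId {ι : Type*} (U : Ultrafilter ι) {E : ι → SuperMap X} {F : SuperMap X}
    (h : ∀ i, CP (E i)) (h' : ∀ i, TNI (E i))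
    (hF : ∀ T, WLim (U : Filter ι) (fun i => (E i T : Op X)) (F T)) (e : X × K ≃ Z) {T : TC Z}
    (hT : 0 ≤ (T : Op Z)) : ∃ S : TC Z, 0 ≤ (S : Op Z) ∧
      (∀ k l, block e k l S = F (block e k l T)) ∧
      WLim (U : Filter ι) (fun i => (tensorId e (E i) T : Op Z)) S := by
  obtain ⟨S, hS, -, hl⟩ := exists_wlim_nonneg U (fun i => tensorId e (E i) T) _
    (fun i => (h i).tensorId_nonneg e hT) fun i => (h' i).tensorId (h i) e T hT
  refine ⟨S, hS, fun k l => Subtype.ext ((hl.conj (slice e k) (slice e l)).unique ?_), hl⟩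
  have h1 : (fun i => slice e k ∘L (tensorId e (E i) T : Op Z) ∘L (slice e l).adjoint)
      = fun i => (E i (block e k l T) : Op X) :=
    funext fun i => congrArg Subtype.val ((h i).block_tensorId e T k l)
  rw [h1]
  exact hF _

/-- A weak limit of completely positive, trace-non-increasing maps is completely positive. -/
theorem CP.of_wlim {ι : Type*} (U : Ultrafilter ι) {E : ι → SuperMap X} {F : SuperMap X}
    (h : ∀ i, CP (E i)) (h' : ∀ i, TNI (E i))
    (hF : ∀ T, WLim (U : Filter ι) (fun i => (E i T : Op X)) (F T)) : CP F :=
  CP.of_exists fun e _ hT => by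
    obtain ⟨S, hS, hb, -⟩ := exists_wlim_tensorId U h h' hF e hT
    exact ⟨S, hS, hb⟩

/-- Weak limits commute with tensoring with an identity. -/
theorem wlim_tensorId {ι : Type*} (U : Ultrafilter ι) {E : ι → SuperMap X} {F : SuperMap X}
    (h : ∀ i, CP (E i)) (h' : ∀ i, TNI (E i))
    (hF : ∀ T, WLim (U : Filter ι) (fun i => (E i T : Op X)) (F T)) (e : X × K ≃ Z) {T : TC Z}
    (hT : 0 ≤ (T : Op Z)) :
    WLim (U : Filter ι) (fun i => (tensorId e (E i) T : Op Z)) (tensorId e F T) := by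
  obtain ⟨S, -, hb, hl⟩ := exists_wlim_tensorId U h h' hF e hT
  rwa [block_ext e (S := tensorId e F T) (T := S) fun k l => by
    rw [(CP.of_wlim U h h' hF).block_tensorId, hb]]

/-! ### Superoperators are completely positive for infinite auxiliary spaces -/

/-- For a finite auxiliary space `E ⊗ I` exists without any assumption on `E`. -/
theorem block_tensorId_of_finite {n : ℕ} (E : SuperMap X) (T : TC (X × Fin n)) (k l : Fin n) :
    block (Equiv.refl _) k l (tensorId (Equiv.refl _) E T) = E (block (Equiv.refl _) k l T) := by
  refine theMap_spec (p := fun F : SuperMap (X × Fin n) => ∀ (T : TC (X × Fin n)) (k l : Fin n),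
    block (Equiv.refl _) k l (F T) = E (block (Equiv.refl _) k l T)) ?_ T k l
  refine ⟨∑ i, ∑ j, sandwich (slice (Equiv.refl _) i).adjoint (slice (Equiv.refl _) j).adjoint
    ∘ₗ E ∘ₗ block (Equiv.refl _) i j, fun T k l => ?_⟩
  have hs : ∀ (i j : Fin n) (S : TC X),
      block (Equiv.refl (X × Fin n)) k l (sandwich (slice (Equiv.refl _) i).adjoint
        (slice (Equiv.refl _) j).adjoint S) = if i = k ∧ j = l then S else 0 := by
    intro i j S
    refine Subtype.ext ?_
    change slice (Equiv.refl (X × Fin n)) k ∘L ((slice (Equiv.refl _) i).adjoint ∘L (S : Op X)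
      ∘L (slice (Equiv.refl _) j).adjoint.adjoint) ∘L (slice (Equiv.refl _) l).adjoint = _
    rw [adjoint_adjoint]
    calc _ = (slice (Equiv.refl (X × Fin n)) k ∘L (slice (Equiv.refl _) i).adjoint) ∘L (S : Op X)
          ∘L (slice (Equiv.refl _) j ∘L (slice (Equiv.refl _) l).adjoint) := rfl
      _ = _ := by
        by_cases hi : i = k
        · subst hi
          by_cases hj : j = l
          · subst hj
            rw [slice_comp_adjoint_self, slice_comp_adjoint_self, if_pos ⟨rfl, rfl⟩]
            rfl
          · rw [slice_comp_adjoint_of_ne _ hj, if_neg fun h => hj h.2, comp_zero, comp_zero]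
            rfl
        · rw [slice_comp_adjoint_of_ne _ (Ne.symm hi), if_neg fun h => hi h.1, zero_comp]
          rfl
  simp only [LinearMap.sum_apply, map_sum, LinearMap.comp_apply, hs]
  rw [Finset.sum_eq_single k (fun i _ hi => by simp [hi]) (by simp),
    Finset.sum_eq_single l (fun j _ hj => by simp [hj]) (by simp)]
  simp

theorem IsSuperoperator.tni (h : IsSuperoperator E) : TNI E := by
  intro T hT
  -- The hypothesis concerns traces at most one, so `T` is rescaled.
  have ht := tr_nonneg T.2 hT
  obtain ⟨r, hr, hr1⟩ : ∃ r : ℝ, 0 < r ∧ r * (tr (T : Op X)).re ≤ 1 :=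
    ⟨((tr (T : Op X)).re + 1)⁻¹, by positivity, by
      rw [inv_mul_le_iff₀ (by positivity)]; linarith⟩
  have h1 := h.trace_le ((r : ℂ) • T) ⟨smul_op_nonneg hT hr.le, by
    rw [Submodule.coe_smul, tr_smul, Complex.re_ofReal_mul]; exact hr1⟩
  rw [map_smul, Submodule.coe_smul, Submodule.coe_smul, tr_smul, tr_smul, Complex.re_ofReal_mul,
    Complex.re_ofReal_mul] at h1
  exact le_of_mul_le_mul_left h1 hr

/-- For a finite family `σ` of distinct basis vectors of the auxiliary space, applying `E ⊗ I` to
the compression of a positive operator gives a positive operator of no larger trace. -/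
theorem IsSuperoperator.exists_finite (h : IsSuperoperator E) (e : X × K ≃ Z) {T : TC Z}
    (hT : 0 ≤ (T : Op Z)) {n : ℕ} {σ : Fin n → K} (hσ : Function.Injective σ) :
    ∃ S : TC Z, 0 ≤ (S : Op Z) ∧ (tr (S : Op Z)).re ≤ (tr (T : Op Z)).re ∧
      ∀ i j, block e (σ i) (σ j) S = E (block e (σ i) (σ j) T) := by
  let d : X × Fin n ≃ X × Fin n := Equiv.refl _
  -- The compression `J` with `(I ⊗ ⟨i|) J = I ⊗ ⟨σ i|`.
  let J : Ell2 Z →L[ℂ] Ell2 (X × Fin n) := ∑ i, (slice d i).adjoint ∘L slice e (σ i)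
  have hJ : ∀ i, slice d i ∘L J = slice e (σ i) := by
    intro i
    have h1 : slice d i ∘L J = ∑ j, slice d i ∘L (slice d j).adjoint ∘L slice e (σ j) := by
      ext1 f
      simp only [J, comp_apply, sum_apply, map_sum]
    rw [h1, Finset.sum_eq_single i]
    · rw [← comp_assoc, slice_comp_adjoint_self]; rfl
    · intro j _ hj
      rw [← comp_assoc, slice_comp_adjoint_of_ne d hj.symm, zero_comp]
    · simp
  have hJ2 : ∀ i, J ∘L (slice e (σ i)).adjoint = (slice d i).adjoint := by
    intro i
    refine slice_ext d fun j => ?_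
    rw [← comp_assoc, hJ]
    by_cases hij : j = i
    · subst hij
      rw [slice_comp_adjoint_self, slice_comp_adjoint_self]
    · rw [slice_comp_adjoint_of_ne d hij, slice_comp_adjoint_of_ne e fun h => hij (hσ h)]
  have hJ3 : ∀ i, slice e (σ i) ∘L J.adjoint = slice d i := by
    intro i
    have := congrArg ContinuousLinearMap.adjoint (hJ2 i)
    rwa [adjoint_comp, adjoint_adjoint, adjoint_adjoint] at this
  have hJ4 : J ∘L J.adjoint = 1 := by
    refine slice_ext d fun i => ?_
    rw [← comp_assoc, hJ, hJ3]
    rfl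
  have hb : ∀ i j, block d i j (sandwich J J T) = block e (σ i) (σ j) T := by
    intro i j
    refine Subtype.ext ?_
    change slice d i ∘L (J ∘L (T : Op Z) ∘L J.adjoint) ∘L (slice d j).adjoint
      = slice e (σ i) ∘L (T : Op Z) ∘L (slice e (σ j)).adjoint
    rw [← hJ i, ← hJ j, adjoint_comp]
    rfl
  let G : TC (X × Fin n) := tensorId d E (sandwich J J T)
  have hG : 0 ≤ (G : Op (X × Fin n)) := h.completelyPositive n _ (conj_nonneg hT J)
  have hGb : ∀ i j, block d i j G = E (block e (σ i) (σ j) T) := fun i j => by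
    rw [← hb]
    exact block_tensorId_of_finite E _ i j
  refine ⟨sandwich J.adjoint J.adjoint G, conj_nonneg hG _, ?_, fun i j => ?_⟩
  · have h1 : tr (sandwich J.adjoint J.adjoint G : Op Z) = tr (G : Op (X × Fin n)) := by
      refine (tr_sandwich J.adjoint J.adjoint G.2).trans ?_
      rw [adjoint_adjoint, ← comp_assoc, hJ4]
      rfl
    rw [h1, ← (hasSum_re_tr_block d G).tsum_eq, tsum_fintype]
    calc ∑ i, (tr (block d i i G : Op X)).re
        ≤ ∑ i, (tr (block e (σ i) (σ i) T : Op X)).re := Finset.sum_le_sum fun i _ => by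
          rw [hGb]
          exact h.tni _ (block_self_nonneg e _ hT)
      _ = ∑ k ∈ Finset.univ.map ⟨σ, hσ⟩, (tr (block e k k T : Op X)).re := by
          rw [Finset.sum_map]; rfl
      _ ≤ _ := sum_le_hasSum _ (fun k _ => tr_nonneg (block e k k T).2 (block_self_nonneg e k hT))
          (hasSum_re_tr_block e T)
  · rw [← hGb]
    refine Subtype.ext ?_
    change slice e (σ i) ∘L (J.adjoint ∘L (G : Op (X × Fin n)) ∘L J.adjoint.adjoint)
      ∘L (slice e (σ j)).adjoint = slice d i ∘L (G : Op (X × Fin n)) ∘L (slice d j).adjoint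
    rw [adjoint_adjoint, ← hJ2 j, ← hJ3 i]
    rfl

/-- Admissible superoperators remain positive when tensored with the identity of an infinite
auxiliary space: the compressions to finite-dimensional auxiliary spaces converge weakly. -/
theorem IsSuperoperator.cp (h : IsSuperoperator E) : CP E :=
  CP.of_exists fun {K Z} e T hT => by
    have h1 : ∀ s : Finset K, ∃ S : TC Z, 0 ≤ (S : Op Z) ∧
        (tr (S : Op Z)).re ≤ (tr (T : Op Z)).re ∧
        ∀ k ∈ s, ∀ l ∈ s, block e k l S = E (block e k l T) := by
      intro s
      let σ := s.equivFin.symm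
      obtain ⟨S, hS, ht, hb⟩ := h.exists_finite e hT (σ := fun i => (σ i : K))
        (Subtype.val_injective.comp σ.injective)
      refine ⟨S, hS, ht, fun k hk l hl => ?_⟩
      have := hb (σ.symm ⟨k, hk⟩) (σ.symm ⟨l, hl⟩)
      simpa only [Equiv.apply_symm_apply] using this
    choose S hS ht hb using h1
    classical
    let U : Ultrafilter (Finset K) := Ultrafilter.of atTop
    have hU : (U : Filter (Finset K)) ≤ atTop := Ultrafilter.of_le _
    obtain ⟨S', hS', -, hl⟩ := exists_wlim_nonneg U S _ hS ht
    refine ⟨S', hS', fun k l => Subtype.ext ((hl.conj (slice e k) (slice e l)).unique ?_)⟩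
    -- As soon as `k` and `l` lie in the finite set, the block at `k`, `l` no longer changes.
    intro f g
    refine tendsto_const_nhds.congr' ?_
    have h2 : ∀ᶠ s : Finset K in atTop, {k, l} ≤ s := eventually_ge_atTop _
    filter_upwards [hU h2] with s hs
    rw [← hb s k (hs (by simp)) l (hs (by simp))]
    rfl

/-! ### Maps in Kraus form -/

theorem etr_conj_family_le {Y ι : Type} {A : ι → Ell2 X →L[ℂ] Ell2 Y}
    (hA : ∀ f, ∑' i, ENNReal.ofReal (‖A i f‖ ^ 2) ≤ ENNReal.ofReal (‖f‖ ^ 2)) {ρ : Op X}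
    (hρ : 0 ≤ ρ) : ∑' i, etr (A i ∘L ρ ∘L (A i).adjoint) ≤ etr ρ := by
  simp_rw [etr_conj hρ]
  rw [ENNReal.tsum_comm, etr_eq_sum_sqrt hρ]
  exact ENNReal.tsum_le_tsum fun x => hA _

/-- A Kraus sum converges in operator norm, since the operator norms of its terms are bounded by
their traces, and these sum up to at most `tr ρ`. -/
theorem exists_kraus_apply {ι : Type} {A : ι → Op X}
    (hA : ∀ f, ∑' i, ENNReal.ofReal (‖A i f‖ ^ 2) ≤ ENNReal.ofReal (‖f‖ ^ 2)) {ρ : TC X}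
    (hρ : 0 ≤ (ρ : Op X)) : ∃ S : TC X, 0 ≤ (S : Op X) ∧
      (tr (S : Op X)).re ≤ (tr (ρ : Op X)).re ∧
      HasSum (fun i => (conj (A i) ρ : Op X)) (S : Op X) := by
  have h1 := etr_conj_family_le hA hρ
  have h0 : ∀ i, 0 ≤ (conj (A i) ρ : Op X) := fun i => conj_nonneg hρ _
  have h2 : Summable fun i => (tr (conj (A i) ρ : Op X)).re := by
    have := ENNReal.summable_toReal (ne_top_of_le_ne_top (etr_ne_top ρ.2 hρ) h1)
    refine this.congr fun i => ?_
    change (etr (conj (A i) ρ : Op X)).toReal = _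
    rw [etr_eq (conj (A i) ρ).2 (h0 i), ENNReal.toReal_ofReal (tr_nonneg (conj (A i) ρ).2 (h0 i))]
  have h3 : ∑' i, (tr (conj (A i) ρ : Op X)).re ≤ (tr (ρ : Op X)).re := by
    rw [← ENNReal.ofReal_le_ofReal_iff (tr_nonneg ρ.2 hρ), ← etr_eq ρ.2 hρ,
      ENNReal.ofReal_tsum_of_nonneg (fun i => tr_nonneg (conj (A i) ρ).2 (h0 i)) h2]
    refine le_trans (le_of_eq (tsum_congr fun i => ?_)) h1
    exact (etr_eq (conj (A i) ρ).2 (h0 i)).symm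
  have h4 : Summable fun i => (conj (A i) ρ : Op X) :=
    Summable.of_norm_bounded h2 fun i => norm_le_tr (conj (A i) ρ).2 (h0 i)
  obtain ⟨S, hS⟩ := h4
  have hw : WLim atTop (fun s : Finset ι => ((∑ i ∈ s, conj (A i) ρ : TC X) : Op X)) S := by
    intro f g
    have hc : Continuous fun T : Op X => ⟪f, T g⟫_ℂ := by fun_prop
    refine ((hc.tendsto S).comp hS).congr fun s => ?_
    simp
  have h5 : ∀ s : Finset ι, 0 ≤ ((∑ i ∈ s, conj (A i) ρ : TC X) : Op X) := fun s => by
    rw [Submodule.coe_sum]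
    exact Finset.sum_nonneg fun i _ => h0 i
  have h6 := hw.nonneg h5
  have h7 := hw.etr_le h5 (c := (tr (ρ : Op X)).re) fun s => by
    have : (tr ((∑ i ∈ s, conj (A i) ρ : TC X) : Op X)).re
        = ∑ i ∈ s, (tr (conj (A i) ρ : Op X)).re := by
      classical
      induction s using Finset.induction_on with
      | empty => simp [tr]
      | insert i s hi ih =>
        rw [Finset.sum_insert hi, Finset.sum_insert hi, tr_add, Complex.add_re, ih]
    rw [this]
    exact (h2.sum_le_tsum s fun i _ => tr_nonneg (conj (A i) ρ).2 (h0 i)).trans h3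
  have h8 := mem_TC_of_etr h6 (ne_top_of_le_ne_top ENNReal.ofReal_ne_top h7)
  refine ⟨⟨S, h8⟩, h6, ?_, hS⟩
  rw [etr_eq h8 h6] at h7
  exact (ENNReal.ofReal_le_ofReal_iff (tr_nonneg ρ.2 hρ)).1 h7

theorem exists_kraus {ι : Type} {A : ι → Op X}
    (hA : ∀ f, ∑' i, ENNReal.ofReal (‖A i f‖ ^ 2) ≤ ENNReal.ofReal (‖f‖ ^ 2)) :
    ∃ F : SuperMap X, ∀ ρ : TC X, HasSum (fun i => (conj (A i) ρ : Op X)) (F ρ : Op X) :=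
  exists_linearMap (fun ρ S : TC X => HasSum (fun i => (conj (A i) ρ : Op X)) (S : Op X))
    (fun h1 h2 => by simpa using h1.add h2) (fun c _ _ h1 => by simpa using h1.const_smul c)
    (fun h1 h2 => Subtype.ext (h1.unique h2))
    fun ρ hρ => (exists_kraus_apply hA hρ).imp fun _ hS => hS.2.2

theorem CP.kraus {ι : Type} {A : ι → Op X}
    (hA : ∀ f, ∑' i, ENNReal.ofReal (‖A i f‖ ^ 2) ≤ ENNReal.ofReal (‖f‖ ^ 2))
    (hE : ∀ ρ : TC X, HasSum (fun i => (QRobust.conj (A i) ρ : Op X)) (E ρ : Op X)) : CP E :=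
  CP.of_exists fun e T hT => by
    have h1 : ∀ f, ∑' i, ENNReal.ofReal (‖tensorOp e (A i) f‖ ^ 2) ≤ ENNReal.ofReal (‖f‖ ^ 2) := by
      intro f
      simp_rw [sum_slice_tensorOp]
      rw [ENNReal.tsum_comm, ← sum_slice e]
      exact ENNReal.tsum_le_tsum fun k => hA _
    obtain ⟨S, hS, -, hs⟩ := exists_kraus_apply h1 hT
    refine ⟨S, hS, fun k l => Subtype.ext ?_⟩
    refine HasSum.unique ?_ (hE (block e k l T))
    have hc : Continuous fun R : Op _ => slice e k ∘L R ∘L (slice e l).adjoint := by fun_prop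
    let φ : Op _ →+ Op X :=
      { toFun := fun R => slice e k ∘L R ∘L (slice e l).adjoint
        map_zero' := by simp
        map_add' := fun R R' => by rw [add_comp, comp_add] }
    have h2 := hs.map φ hc
    have h3 : φ ∘ (fun i => (QRobust.conj (tensorOp e (A i)) T : Op _))
        = fun i => (QRobust.conj (A i) (block e k l T) : Op X) :=
      funext fun i => congrArg Subtype.val (block_conj_tensorOp e k l (A i) T)
    rwa [h3] at h2

theorem TNI.kraus {ι : Type} {A : ι → Op X}
    (hA : ∀ f, ∑' i, ENNReal.ofReal (‖A i f‖ ^ 2) ≤ ENNReal.ofReal (‖f‖ ^ 2))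
    (hE : ∀ ρ : TC X, HasSum (fun i => (conj (A i) ρ : Op X)) (E ρ : Op X)) : TNI E := by
  intro T hT
  obtain ⟨S, -, ht, hs⟩ := exists_kraus_apply hA hT
  rwa [(hE T).unique hs]

end CP

/-! ### Least upper bounds of increasing sequences of maps -/

section Sup
variable {X : Type}

theorem le_of_inner {A B : Op X} (hA : IsSelfAdjoint A) (hB : IsSelfAdjoint B)
    (h : ∀ f, (⟪f, A f⟫_ℂ).re ≤ (⟪f, B f⟫_ℂ).re) : A ≤ B := by
  rw [← sub_nonneg]
  refine nonneg_of_inner (fun f => ?_) (fun f => ?_)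
  · rw [sub_apply, inner_sub_right, Complex.sub_re]
    linarith [h f]
  · rw [← Complex.conj_eq_iff_im, inner_conj_symm, ← adjoint_inner_right,
      show adjoint (B - A) = B - A from (hB.sub hA).star_eq]

/-- A monotone sequence of operators has its weak limit as its least upper bound. -/
theorem isLUB_of_wlim {T : ℕ → Op X} {S : Op X} (hT : ∀ k, 0 ≤ T k) (hmono : Monotone T)
    (hS : WLim (hyperfilter ℕ : Filter ℕ) T S) : IsLUB (Set.range T) S := by
  have hS0 := hS.nonneg hT
  have hre : ∀ f, Tendsto (fun k => (⟪f, T k f⟫_ℂ).re) (hyperfilter ℕ : Filter ℕ)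
      (𝓝 (⟪f, S f⟫_ℂ).re) := fun f => (Complex.continuous_re.tendsto _).comp (hS f f)
  constructor
  · rintro _ ⟨k, rfl⟩
    refine le_of_inner (hT k).isSelfAdjoint hS0.isSelfAdjoint fun f => ?_
    refine ge_of_tendsto (hre f) ?_
    have h1 : ∀ᶠ j : ℕ in atTop, k ≤ j := eventually_ge_atTop k
    filter_upwards [Nat.hyperfilter_le_atTop h1] with j hj
    exact re_inner_mono (hmono hj) f
  · intro D hD
    have hD0 : 0 ≤ D := (hT 0).trans (hD ⟨0, rfl⟩)
    refine le_of_inner hS0.isSelfAdjoint hD0.isSelfAdjoint fun f => ?_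
    exact le_of_tendsto' (hre f) fun k => re_inner_mono (hD ⟨k, rfl⟩) f

/-- For an increasing sequence of positive trace-non-increasing maps the least upper bound exists
and is the pointwise weak limit. -/
theorem supMap_wlim {E : ℕ → SuperMap X} (h0 : ∀ k (ρ : TC X), 0 ≤ (ρ : Op X) → 0 ≤ (E k ρ : Op X))
    (h1 : ∀ k, TNI (E k)) (hmono : ∀ ρ : TC X, 0 ≤ (ρ : Op X) → Monotone fun k => (E k ρ : Op X))
    (T : TC X) :
    WLim (hyperfilter ℕ : Filter ℕ) (fun k => (E k T : Op X)) (supMap E T) := by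
  obtain ⟨F, hF⟩ := exists_linearMap
    (fun T S : TC X => WLim (hyperfilter ℕ : Filter ℕ) (fun k => (E k T : Op X)) S)
    (fun h1 h2 => by simpa using h1.add h2) (fun c _ _ h1 => by simpa using h1.smul c)
    (fun h1 h2 => Subtype.ext (h1.unique h2))
    (fun ρ hρ => (exists_wlim_nonneg (hyperfilter ℕ) (fun k => E k ρ) _ (fun k => h0 k ρ hρ)
      fun k => h1 k ρ hρ).imp fun _ h => h.2.2)
  have hlub : ∀ ρ : TC X, 0 ≤ (ρ : Op X) → IsLUB (Set.range fun k => (E k ρ : Op X)) (F ρ : Op X) :=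
    fun ρ hρ => isLUB_of_wlim (fun k => h0 k ρ hρ) (hmono ρ hρ) (hF ρ)
  have hsup := theMap_spec (p := fun F : SuperMap X => ∀ ρ : TC X, 0 ≤ (ρ : Op X) →
    IsLUB (Set.range fun k => (E k ρ : Op X)) (F ρ : Op X)) ⟨F, hlub⟩
  have heq : supMap E = F :=
    superMap_ext fun ρ hρ => Subtype.ext ((hsup ρ hρ).unique (hlub ρ hρ))
  rw [heq]
  exact hF T

theorem TNI.of_wlim {ι : Type*} (U : Ultrafilter ι) {E : ι → SuperMap X} {F : SuperMap X}
    (h : ∀ i, CP (E i)) (h' : ∀ i, TNI (E i))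
    (hF : ∀ T, WLim (U : Filter ι) (fun i => (E i T : Op X)) (F T)) : TNI F := by
  intro T hT
  have h1 := (hF T).etr_le (fun i => (h i).nonneg hT) fun i => h' i T hT
  have h2 := (hF T).nonneg fun i => (h i).nonneg hT
  rw [etr_eq (F T).2 h2] at h1
  exact (ENNReal.ofReal_le_ofReal_iff (tr_nonneg T.2 hT)).1 h1

/-! ### Loops -/

theorem tr_conj_add_tr_conj {M₀ M₁ : Op X} (hM : star M₀ * M₀ + star M₁ * M₁ = 1) (T : TC X) :
    (tr (conj M₀ T : Op X)).re + (tr (conj M₁ T : Op X)).re = (tr (T : Op X)).re := by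
  rw [tr_conj, tr_conj, ← Complex.add_re, ← tr_mul_add_left, hM, one_mul]

variable {M₀ M₁ : Op X} {E : SuperMap X}

theorem CP.unrolling (hE : CP E) (k : ℕ) : CP (unrolling M₀ M₁ E k) := by
  induction k with
  | zero => exact CP.zero
  | succ k ih => exact (CP.conj M₀).add (ih.comp (hE.comp (CP.conj M₁)))

theorem TNI.unrolling (hM : star M₀ * M₀ + star M₁ * M₁ = 1)
    (hE0 : ∀ ρ : TC X, 0 ≤ (ρ : Op X) → 0 ≤ (E ρ : Op X)) (hE : TNI E) (k : ℕ) :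
    TNI (unrolling M₀ M₁ E k) := by
  induction k with
  | zero =>
    intro T hT
    simpa [QRobust.unrolling, tr] using tr_nonneg T.2 hT
  | succ k ih =>
    intro T hT
    have h1 : 0 ≤ (conj M₁ T : Op X) := conj_nonneg hT _
    have h2 : (tr (QRobust.unrolling M₀ M₁ E (k + 1) T : Op X)).re = (tr (conj M₀ T : Op X)).re
        + (tr (QRobust.unrolling M₀ M₁ E k (E (conj M₁ T)) : Op X)).re := by
      rw [← Complex.add_re, ← tr_add]; rfl
    rw [h2, ← tr_conj_add_tr_conj hM T]
    exact add_le_add le_rfl ((ih _ (hE0 _ h1)).trans (hE _ h1))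

theorem unrolling_nonneg (hE0 : ∀ ρ : TC X, 0 ≤ (ρ : Op X) → 0 ≤ (E ρ : Op X)) (k : ℕ) {ρ : TC X}
    (hρ : 0 ≤ (ρ : Op X)) : 0 ≤ (unrolling M₀ M₁ E k ρ : Op X) := by
  induction k generalizing ρ with
  | zero => exact le_rfl
  | succ k ih => exact add_nonneg (conj_nonneg hρ _) (ih (hE0 _ (conj_nonneg hρ _)))

theorem unrolling_mono (hE0 : ∀ ρ : TC X, 0 ≤ (ρ : Op X) → 0 ≤ (E ρ : Op X)) {ρ : TC X}
    (hρ : 0 ≤ (ρ : Op X)) : Monotone fun k => (unrolling M₀ M₁ E k ρ : Op X) := by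
  refine monotone_nat_of_le_succ fun k => ?_
  induction k generalizing ρ with
  | zero => exact unrolling_nonneg hE0 1 hρ
  | succ k ih => exact add_le_add le_rfl (ih (hE0 _ (conj_nonneg hρ _)))

theorem supMap_unrolling_wlim (hM : star M₀ * M₀ + star M₁ * M₁ = 1) (h : CP E) (h' : TNI E)
    (T : TC X) : WLim (hyperfilter ℕ : Filter ℕ) (fun k => (unrolling M₀ M₁ E k T : Op X))
      (supMap (unrolling M₀ M₁ E) T) :=
  supMap_wlim (fun k _ hρ => unrolling_nonneg (fun _ => h.nonneg) k hρ)
    (TNI.unrolling hM (fun _ => h.nonneg) h')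
    (fun _ hρ => unrolling_mono (fun _ => h.nonneg) hρ) T

theorem CP.supMap_unrolling (hM : star M₀ * M₀ + star M₁ * M₁ = 1) (h : CP E) (h' : TNI E) :
    CP (supMap (QRobust.unrolling M₀ M₁ E)) :=
  CP.of_wlim (hyperfilter ℕ) h.unrolling (TNI.unrolling hM (fun _ => h.nonneg) h')
    (supMap_unrolling_wlim hM h h')

theorem TNI.supMap_unrolling (hM : star M₀ * M₀ + star M₁ * M₁ = 1) (h : CP E) (h' : TNI E) :
    TNI (supMap (QRobust.unrolling M₀ M₁ E)) :=
  TNI.of_wlim (hyperfilter ℕ) h.unrolling (TNI.unrolling hM (fun _ => h.nonneg) h')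
    (supMap_unrolling_wlim hM h h')

theorem tensorId_unrolling {K Z : Type} (e : X × K ≃ Z) (hE : CP E) (k : ℕ) :
    tensorId e (unrolling M₀ M₁ E k)
      = unrolling (tensorOp e M₀) (tensorOp e M₁) (tensorId e E) k := by
  induction k with
  | zero => exact CP.zero.tensorId_eq e fun _ _ _ => by simp [unrolling]
  | succ k ih =>
    rw [unrolling, (CP.conj M₀).tensorId_add (hE.unrolling k |>.comp (hE.comp (CP.conj M₁))),
      (hE.unrolling k).tensorId_comp (hE.comp (CP.conj M₁)), hE.tensorId_comp (CP.conj M₁), ih,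
      tensorId_conj, tensorId_conj]
    rfl

/-! ### Measurements followed by branches -/

theorem sum_tr_conj {n : ℕ} {M : Fin n → Op X} (hM : ∑ m, star (M m) * M m = 1) (T : TC X) :
    ∑ m, (tr (conj (M m) T : Op X)).re = (tr (T : Op X)).re := by
  simp_rw [tr_conj]
  rw [← Complex.re_sum, ← tr_mul_sum_left, hM, one_mul]

theorem tr_coe_sum {ι : Type*} (s : Finset ι) (T : ι → TC X) :
    tr ((∑ i ∈ s, T i : TC X) : Op X) = ∑ i ∈ s, tr (T i : Op X) := by
  classical
  induction s using Finset.induction_on with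
  | empty => simp [tr]
  | insert i s hi ih => rw [Finset.sum_insert hi, Finset.sum_insert hi, tr_add, ih]

theorem TNI.sum_comp_conj {n : ℕ} {M : Fin n → Op X} (hM : ∑ m, star (M m) * M m = 1)
    {E : Fin n → SuperMap X} (h : ∀ m, TNI (E m)) : TNI (∑ m, E m ∘ₗ conj (M m)) := by
  intro T hT
  rw [LinearMap.sum_apply, tr_coe_sum, Complex.re_sum, ← sum_tr_conj hM T]
  exact Finset.sum_le_sum fun m _ => h m _ (conj_nonneg hT _)

theorem TNI.comp {E E' : SuperMap X} (h : TNI E) (h' : TNI E') (h0 : CP E') : TNI (E ∘ₗ E') :=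
  fun T hT => (h _ (h0.nonneg hT)).trans (h' T hT)

theorem TNI.id : TNI (LinearMap.id : SuperMap X) := fun _ _ => le_rfl

theorem TNI.conj_unitary {U : Op X} (hU : star U * U = 1) : TNI (conj U) := fun T _ => by
  rw [tr_conj, hU, one_mul]

/-- Convex combinations of trace-non-increasing maps. -/
theorem TNI.convex {E E' : SuperMap X} (h : TNI E) (h' : TNI E') {p : ℝ} (hp : 0 ≤ p)
    (hp' : p ≤ 1) : TNI ((1 - (p : ℂ)) • E + (p : ℂ) • E') := by
  intro T hT
  have h1 : (((1 - (p : ℂ)) • E + (p : ℂ) • E') T : TC X)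
      = ((1 - p : ℝ) : ℂ) • E T + (p : ℂ) • E' T := by
    rw [LinearMap.add_apply, LinearMap.smul_apply, LinearMap.smul_apply, Complex.ofReal_sub,
      Complex.ofReal_one]
  rw [h1, tr_add, Complex.add_re, Submodule.coe_smul, Submodule.coe_smul, tr_smul, tr_smul,
    Complex.re_ofReal_mul, Complex.re_ofReal_mul]
  have := mul_le_mul_of_nonneg_left (h T hT) (sub_nonneg.2 hp')
  have := mul_le_mul_of_nonneg_left (h' T hT) hp
  linarith

end Sup

/-! ### The denotations of programs are completely positive and trace-non-increasing -/

section Programs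
variable {V : Type} [DecidableEq V] {B : V → Type}

theorem liftOp_star_mul {s : Finset V} (A : Op (Reg B s)) :
    star (liftOp s A) * liftOp s A = liftOp s (star A * A) := by
  rw [liftOp, liftOp, tensorOp_mul, tensorOp_star]

theorem Measurement.sum_lift {s : Finset V} {n : ℕ} (M : Measurement (Reg B s) n) :
    ∑ m, star (M.lift m) * M.lift m = 1 := by
  simp_rw [Measurement.lift, liftOp_star_mul]
  unfold liftOp
  rw [← tensorOp_sum, M.complete, tensorOp_one]

theorem Measurement.lift_add {s : Finset V} (M : Measurement (Reg B s) 2) :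
    star (M.lift 0) * M.lift 0 + star (M.lift 1) * M.lift 1 = 1 := by
  rw [← M.sum_lift, Fin.sum_univ_two]

theorem kraus_init (zero : ∀ q, B q) (q : V) (f : Ell2 (Conf B)) :
    ∑' n : Reg B {q}, ENNReal.ofReal
      (‖liftOp {q} (ketBra (fun x => zero x) n) f‖ ^ 2) ≤ ENNReal.ofReal (‖f‖ ^ 2) := by
  unfold liftOp
  simp_rw [sum_slice_tensorOp]
  rw [ENNReal.tsum_comm, ← sum_slice (split B {q})]
  refine ENNReal.tsum_le_tsum fun k => ?_
  rw [Ell2.ofReal_norm_sq]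
  refine ENNReal.tsum_le_tsum fun n => ?_
  rw [ketBra, InnerProductSpace.rankOne_apply, norm_smul, norm_ket, mul_one]

theorem initMap_hasSum (zero : ∀ q, B q) (q : V) (ρ : TC (Conf B)) :
    HasSum (fun n : Reg B {q} =>
      (conj (liftOp {q} (ketBra (fun x => zero x) n)) ρ : Op (Conf B)))
      (initMap zero q ρ : Op (Conf B)) :=
  theMap_spec (p := fun F : SuperMap (Conf B) => ∀ ρ : TC (Conf B),
    HasSum (fun n : Reg B {q} =>
      (conj (liftOp {q} (ketBra (fun x => zero x) n)) ρ : Op (Conf B))) (F ρ : Op (Conf B)))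
    (exists_kraus (kraus_init zero q)) ρ

theorem star_liftOp_unitary {s : Finset V} (U : unitary (Op (Reg B s))) :
    star (liftOp s U.1) * liftOp s U.1 = (1 : Op (Conf B)) := by
  rw [liftOp_star_mul, Unitary.star_mul_self_of_mem U.2]
  exact tensorOp_one _

theorem Prog.sem_cp_tni (zero : ∀ q, B q) (P : Prog B) : CP (P.sem zero) ∧ TNI (P.sem zero) := by
  induction P with
  | skip => exact ⟨CP.id, TNI.id⟩
  | initVar q => exact ⟨CP.kraus (kraus_init zero q) (initMap_hasSum zero q),
      TNI.kraus (kraus_init zero q) (initMap_hasSum zero q)⟩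
  | unitary s U => exact ⟨CP.conj _, TNI.conj_unitary (star_liftOp_unitary U)⟩
  | seq P₁ P₂ h₁ h₂ => exact ⟨h₂.1.comp h₁.1, h₂.2.comp h₁.2 h₁.1⟩
  | cases s n M P h => exact ⟨CP.sum _ fun m _ => (h m).1.comp (CP.conj _),
      TNI.sum_comp_conj M.sum_lift fun m => (h m).2⟩
  | loop s M P h => exact ⟨CP.supMap_unrolling M.lift_add h.1 h.2,
      TNI.supMap_unrolling M.lift_add h.1 h.2⟩

theorem NoisyProg.sem_cp_tni (zero : ∀ q, B q) (P : NoisyProg B) :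
    CP (P.sem zero) ∧ TNI (P.sem zero) := by
  induction P with
  | skip => exact ⟨CP.id, TNI.id⟩
  | initVar q => exact ⟨CP.kraus (kraus_init zero q) (initMap_hasSum zero q),
      TNI.kraus (kraus_init zero q) (initMap_hasSum zero q)⟩
  | unitary s U p Φ =>
    refine ⟨?_, TNI.convex (TNI.conj_unitary (star_liftOp_unitary U))
      (Φ.2.tni.tensorId Φ.2.cp _) p.2.1 p.2.2⟩
    have h : CP (((1 - p : ℝ) : ℂ) • conj (liftOp s U.1) + ((p : ℝ) : ℂ) • liftMap s Φ.1) :=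
      ((CP.conj _).smul (sub_nonneg.2 p.2.2)).add ((Φ.2.cp.tensorId _).smul p.2.1)
    simpa [NoisyProg.sem] using h
  | seq P₁ P₂ h₁ h₂ => exact ⟨h₂.1.comp h₁.1, h₂.2.comp h₁.2 h₁.1⟩
  | cases s n M P h => exact ⟨CP.sum _ fun m _ => (h m).1.comp (CP.conj _),
      TNI.sum_comp_conj M.sum_lift fun m => (h m).2⟩
  | loop s M P h => exact ⟨CP.supMap_unrolling M.lift_add h.1 h.2,
      TNI.supMap_unrolling M.lift_add h.1 h.2⟩

end Programs

/-! ### Robustness in terms of positive operators -/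

/-- The bound `ε` on the `(Q, lam)`-diamond distance, in homogeneous form: the density operators
are replaced by arbitrary positive trace-class operators `ρ`, the threshold `lam` by `lam * tr ρ`
and the bound `ε` by `ε * tr ρ`. -/
def DistLE {X : Type} (Q : Op X) (lam : ℝ) (E E' : SuperMap X) (ε : ℝ) : Prop :=
  ∀ (K : Type) (ρ : TC (X × K)), 0 ≤ (ρ : Op (X × K)) →
    lam * (tr (ρ : Op (X × K))).re
      ≤ (tr (tensorOp (Equiv.refl (X × K)) Q * (ρ : Op (X × K)))).re →
    HermLE ((tensorId (Equiv.refl (X × K)) E ρ : Op (X × K)) -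
      (tensorId (Equiv.refl (X × K)) E' ρ : Op (X × K))) (2 * ε * (tr (ρ : Op (X × K))).re)

section Dist
variable {X : Type} {Q : Op X} {lam ε : ℝ} {E E' : SuperMap X}

/-- Two trace-non-increasing maps have trace distance at most one. -/
theorem hermLE_sub {Z : Type} {F F' : SuperMap Z}
    (hF : ∀ ρ : TC Z, 0 ≤ (ρ : Op Z) → 0 ≤ (F ρ : Op Z))
    (hF' : ∀ ρ : TC Z, 0 ≤ (ρ : Op Z) → 0 ≤ (F' ρ : Op Z)) (h : TNI F) (h' : TNI F') {ρ : TC Z}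
    (hρ : 0 ≤ (ρ : Op Z)) : HermLE ((F ρ : Op Z) - (F' ρ : Op Z)) (2 * (tr (ρ : Op Z)).re) :=
  (HermLE.sub_of_nonneg (hF ρ hρ) (hF' ρ hρ)).mono (by linarith [h ρ hρ, h' ρ hρ])

theorem hermLE_sub_tensorId (hE : CP E) (hE' : CP E') (h : TNI E) (h' : TNI E') {K Z : Type}
    (e : X × K ≃ Z) {ρ : TC Z} (hρ : 0 ≤ (ρ : Op Z)) :
    HermLE ((tensorId e E ρ : Op Z) - (tensorId e E' ρ : Op Z)) (2 * (tr (ρ : Op Z)).re) :=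
  hermLE_sub (fun _ => hE.tensorId_nonneg e) (fun _ => hE'.tensorId_nonneg e) (h.tensorId hE e)
    (h'.tensorId hE' e) hρ

theorem DistLE.diamondDist_le (h : DistLE Q lam E E' ε) :
    diamondDist Q lam E E' ≤ ENNReal.ofReal ε := by
  refine iSup_le fun K => iSup_le fun ρ => iSup_le fun hρ => iSup_le fun hQ => ?_
  have h1 := (h K ρ hρ.1 (by rwa [hρ.2, Complex.one_re, mul_one])).traceNorm_le
  rw [hρ.2, Complex.one_re, mul_one] at h1
  refine ENNReal.div_le_of_le_mul (h1.trans_eq ?_)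
  rw [mul_comm, ENNReal.ofReal_mul' zero_le_two]
  simp

/-- The diamond distance only involves operators of trace one; the general case follows by scaling,
the case of trace zero being trivial. -/
theorem DistLE.of_diamondDist_le (hE : CP E) (hE' : CP E') (h : TNI E) (h' : TNI E') (hε : 0 ≤ ε)
    (hd : diamondDist Q lam E E' ≤ ENNReal.ofReal ε) : DistLE Q lam E E' ε := by
  intro K ρ hρ hQ
  have ht := tr_nonneg ρ.2 hρ
  rcases ht.eq_or_lt with h0 | h0
  · have : ρ = 0 := Subtype.ext (eq_zero_of_tr_eq_zero ρ.2 hρ h0.symm)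
    subst this
    simpa [tr] using HermLE.zero
  · set t := (tr (ρ : Op (X × K))).re with htdef
    have hr : 0 ≤ t⁻¹ := inv_nonneg.2 ht
    let σ : TC (X × K) := ((t⁻¹ : ℝ) : ℂ) • ρ
    have hσ0 : 0 ≤ (σ : Op (X × K)) := smul_op_nonneg hρ hr
    have hσ1 : tr (σ : Op (X × K)) = 1 := by
      refine Complex.ext ?_ ?_
      · change (tr (((t⁻¹ : ℝ) : ℂ) • (ρ : Op (X × K)))).re = 1
        rw [tr_smul, Complex.re_ofReal_mul, ← htdef, inv_mul_cancel₀ h0.ne']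
      · rw [tr_im σ.2 hσ0, Complex.one_im]
    have hσQ : lam ≤ (tr (tensorOp (Equiv.refl (X × K)) Q * (σ : Op (X × K)))).re := by
      change lam ≤ (tr (tensorOp (Equiv.refl (X × K)) Q * (((t⁻¹ : ℝ) : ℂ) • (ρ : Op (X × K))))).re
      rw [mul_smul_comm, tr_smul, Complex.re_ofReal_mul, ← div_eq_inv_mul, le_div_iff₀ h0]
      exact hQ
    have h1 : traceDist (tensorId (Equiv.refl (X × K)) E σ : Op (X × K))
        (tensorId (Equiv.refl (X × K)) E' σ) ≤ ENNReal.ofReal ε :=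
      by
        simp only [diamondDist, iSup_le_iff] at hd
        exact hd K σ ⟨hσ0, hσ1⟩ hσQ
    have h2 : traceNorm ((tensorId (Equiv.refl (X × K)) E σ : Op (X × K)) -
        (tensorId (Equiv.refl (X × K)) E' σ : Op (X × K))) ≤ ENNReal.ofReal (2 * ε) := by
      have h3 : traceNorm ((tensorId (Equiv.refl (X × K)) E σ : Op (X × K)) -
        (tensorId (Equiv.refl (X × K)) E' σ : Op (X × K))) ≤ ENNReal.ofReal ε * 2 :=
        (ENNReal.div_le_iff two_ne_zero ENNReal.ofNat_ne_top).1 h1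
      refine h3.trans_eq ?_
      rw [mul_comm 2 ε, ENNReal.ofReal_mul' zero_le_two]
      simp
    have h4 := (HermLE.of_traceNorm_le (hermLE_sub_tensorId hE hE' h h' (Equiv.refl _) hσ0) h2
      (by positivity)).smul ht
    have h5 : (t : ℂ) • ((tensorId (Equiv.refl (X × K)) E σ : Op (X × K)) -
        (tensorId (Equiv.refl (X × K)) E' σ : Op (X × K)))
        = (tensorId (Equiv.refl (X × K)) E ρ : Op (X × K)) -
          (tensorId (Equiv.refl (X × K)) E' ρ : Op (X × K)) := by
      have h6 : (t : ℂ) • σ = ρ := by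
        change (t : ℂ) • ((t⁻¹ : ℝ) : ℂ) • ρ = ρ
        rw [smul_smul, ← Complex.ofReal_mul, mul_inv_cancel₀ h0.ne', Complex.ofReal_one, one_smul]
      have h7 : ∀ F : SuperMap (X × K), F ρ = (t : ℂ) • F σ := fun F => by rw [← map_smul, h6]
      rw [h7, h7, smul_sub]
      rfl
    rw [h5] at h4
    exact h4.mono (by linarith)

theorem DistLE.mono {Q' : Op X} {lam' ε' : ℝ} (h : DistLE Q' lam' E E' ε') (hε : ε' ≤ ε)
    (hQ : Q ≤ Q') (hlam : lam' ≤ lam) : DistLE Q lam E E' ε := by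
  intro K ρ hρ hl
  have ht := tr_nonneg ρ.2 hρ
  refine (h K ρ hρ ?_).mono ?_
  · exact (mul_le_mul_of_nonneg_right hlam ht).trans
      (hl.trans (tr_mul_mono (tensorOp_mono _ hQ) hρ))
  · exact mul_le_mul_of_nonneg_right (by linarith) ht

theorem DistLE.rescale {δ : ℝ} (hδ : 0 < δ) (h : DistLE ((δ⁻¹ : ℂ) • Q) (lam / δ) E E' ε) :
    DistLE Q lam E E' ε := by
  intro K ρ hρ hl
  refine h K ρ hρ ?_
  rw [tensorOp_smul, tr_mul_smul_left, ← Complex.ofReal_inv, Complex.re_ofReal_mul,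
    div_mul_eq_mul_div, div_eq_inv_mul]
  exact mul_le_mul_of_nonneg_left hl (inv_nonneg.2 hδ.le)

theorem DistLE.self : DistLE Q lam E E 0 := by
  intro K ρ _ _
  rw [sub_self, mul_zero, zero_mul]
  exact HermLE.zero

/-- Noise that occurs with probability `p` contributes `p` times its distance. -/
theorem DistLE.mixture {p : ℝ} (hE : CP E) (hE' : CP E') (hp : 0 ≤ p) (hp' : p ≤ 1)
    (h : DistLE Q lam E E' ε) :
    DistLE Q lam ((1 - (p : ℂ)) • E + (p : ℂ) • E') E (p * ε) := by
  intro K ρ hρ hl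
  have h1 : (1 - (p : ℂ)) • E = ((1 - p : ℝ) : ℂ) • E := by
    rw [Complex.ofReal_sub, Complex.ofReal_one]
  have h2 := ((h K ρ hρ hl).smul hp).neg
  rw [h1, (hE.smul (sub_nonneg.2 hp')).tensorId_add (hE'.smul hp),
    hE.tensorId_smul (sub_nonneg.2 hp'), hE'.tensorId_smul hp]
  refine HermLE.mono (c := p * (2 * ε * (tr (ρ : Op (X × K))).re)) ?_ (by linarith)
  convert h2 using 1
  simp only [LinearMap.add_apply, LinearMap.smul_apply, Submodule.coe_add, Submodule.coe_smul,
    Complex.ofReal_sub, Complex.ofReal_one]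
  module

/-- A Hoare triple remains valid in the presence of an auxiliary space. -/
theorem tr_tensorOp_le {R : Op X} (hE : CP E)
    (h : ∀ ρ : TC X, IsPartialDensity ρ →
      (tr (Q * (ρ : Op X))).re ≤ (tr (R * (E ρ : Op X))).re) {K Z : Type} (e : X × K ≃ Z) {T : TC Z}
    (hT : 0 ≤ (T : Op Z)) :
    (tr (tensorOp e Q * (T : Op Z))).re ≤ (tr (tensorOp e R * (tensorId e E T : Op Z))).re := by
  have h1 : ∀ ρ : TC X, 0 ≤ (ρ : Op X) →
      (tr (Q * (ρ : Op X))).re ≤ (tr (R * (E ρ : Op X))).re := by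
    intro ρ hρ
    have ht := tr_nonneg ρ.2 hρ
    obtain ⟨r, hr, hr1⟩ : ∃ r : ℝ, 0 < r ∧ r * (tr (ρ : Op X)).re ≤ 1 :=
      ⟨((tr (ρ : Op X)).re + 1)⁻¹, by positivity, by
        rw [inv_mul_le_iff₀ (by positivity)]; linarith⟩
    have h1 := h ((r : ℂ) • ρ) ⟨smul_op_nonneg hρ hr.le, by
      rw [Submodule.coe_smul, tr_smul, Complex.re_ofReal_mul]; exact hr1⟩
    rw [map_smul, Submodule.coe_smul, Submodule.coe_smul, mul_smul_comm, mul_smul_comm, tr_smul,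
      tr_smul, Complex.re_ofReal_mul, Complex.re_ofReal_mul] at h1
    exact le_of_mul_le_mul_left h1 hr
  refine hasSum_le (fun k => ?_) (hasSum_re_tr_mul_block e Q T) (hasSum_re_tr_mul_block e R _)
  rw [hE.block_tensorId]
  exact h1 _ (block_self_nonneg e k hT)

/-- Sequential composition: the error of the second map is evaluated on the ideal output of the
first one, which satisfies the second predicate by the Hoare triple. -/
theorem DistLE.comp {Q' : Op X} {E₁ E₁' E₂ E₂' : SuperMap X} {ε₁ ε₂ : ℝ}
    (c₁ : CP E₁) (c₁' : CP E₁') (c₂ : CP E₂) (c₂' : CP E₂')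
    (t₁' : TNI E₁') (t₂ : TNI E₂) (hlam : 0 ≤ lam) (hε₂ : 0 ≤ ε₂)
    (h₁ : DistLE Q lam E₁ E₁' ε₁) (h₂ : DistLE Q' lam E₂ E₂' ε₂)
    (h : ∀ ρ : TC X, IsPartialDensity ρ →
      (tr (Q * (ρ : Op X))).re ≤ (tr (Q' * (E₁' ρ : Op X))).re) :
    DistLE Q lam (E₂ ∘ₗ E₁) (E₂' ∘ₗ E₁') (ε₁ + ε₂) := by
  intro K ρ hρ hl
  rw [c₂.tensorId_comp c₁, c₂'.tensorId_comp c₁']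
  have hσ : 0 ≤ (tensorId (Equiv.refl (X × K)) E₁' ρ : Op (X × K)) := c₁'.tensorId_nonneg _ hρ
  have hσt := t₁'.tensorId c₁' (Equiv.refl (X × K)) ρ hρ
  have e1 := HermLE.map (tensorId (Equiv.refl (X × K)) E₂) (fun _ => c₂.tensorId_nonneg _)
    (t₂.tensorId c₂ _)
    (T := tensorId (Equiv.refl (X × K)) E₁ ρ - tensorId (Equiv.refl (X × K)) E₁' ρ) (h₁ K ρ hρ hl)
  have e2 := h₂ K _ hσ ((mul_le_mul_of_nonneg_left hσt hlam).trans
    (hl.trans (tr_tensorOp_le c₁' h _ hρ)))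
  refine HermLE.mono (c := 2 * ε₁ * (tr (ρ : Op (X × K))).re + 2 * ε₂ *
    (tr (tensorId (Equiv.refl (X × K)) E₁' ρ : Op (X × K))).re) ?_ ?_
  · convert e1.add e2 using 1
    rw [map_sub, Submodule.coe_sub, LinearMap.comp_apply, LinearMap.comp_apply]
    abel
  · have := mul_le_mul_of_nonneg_left hσt (by positivity : 0 ≤ 2 * ε₂)
    linarith

/-- Markov's inequality: if the average of `s m / p m` is at least `1 - t * δ`, then the `m` with
`s m / p m < 1 - δ` have total weight at most `t`. -/
theorem sum_filter_lt_le {n : ℕ} {p s : Fin n → ℝ} {t δ : ℝ} (hsp : ∀ m, s m ≤ p m)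
    (hδ : 0 ≤ δ) (ht : 0 ≤ t) (hp : ∀ m, 0 ≤ p m)
    (h : (1 - t * δ) * ∑ m, p m ≤ ∑ m, s m) :
    ∑ m with s m < (1 - δ) * p m, p m ≤ t * ∑ m, p m := by
  have h1 : ∑ m, (p m - s m) ≤ t * δ * ∑ m, p m := by
    rw [Finset.sum_sub_distrib]; linarith
  rcases hδ.eq_or_lt with rfl | hδ
  · have h2 : ∀ m, p m - s m = 0 := by
      have h3 : ∑ m, (p m - s m) = 0 :=
        le_antisymm (by simpa using h1) (Finset.sum_nonneg fun m _ => sub_nonneg.2 (hsp m))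
      intro m
      exact (Finset.sum_eq_zero_iff_of_nonneg fun m _ => sub_nonneg.2 (hsp m)).1 h3 m
        (Finset.mem_univ m)
    rw [Finset.filter_false_of_mem fun m _ => by linarith [h2 m], Finset.sum_empty]
    exact mul_nonneg ht (Finset.sum_nonneg fun m _ => hp m)
  · refine le_of_mul_le_mul_left ?_ hδ
    calc δ * ∑ m with s m < (1 - δ) * p m, p m
        = ∑ m with s m < (1 - δ) * p m, δ * p m := Finset.mul_sum _ _ _
      _ ≤ ∑ m with s m < (1 - δ) * p m, (p m - s m) := Finset.sum_le_sum fun m hm => by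
          linarith [(Finset.mem_filter.1 hm).2]
      _ ≤ ∑ m, (p m - s m) := Finset.sum_le_sum_of_subset_of_nonneg (Finset.filter_subset _ _)
          fun m _ _ => sub_nonneg.2 (hsp m)
      _ ≤ δ * (t * ∑ m, p m) := by linarith

/-- Case statements: on the branches whose input satisfies `R m` to degree `1 - δ` the error is at
most `ε`, and the other branches have total weight at most `t`. -/
theorem DistLE.measure {n : ℕ} {M : Fin n → Op X} (hM : ∑ m, star (M m) * M m = 1)
    {F F' : Fin n → SuperMap X} {R : Fin n → Op X} {t δ : ℝ} (ht : 0 ≤ t) (ht' : t ≤ 1)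
    (hδ : 0 ≤ δ) (hR : ∀ m, R m ≤ 1) (c : ∀ m, CP (F m)) (c' : ∀ m, CP (F' m))
    (i : ∀ m, TNI (F m)) (i' : ∀ m, TNI (F' m)) (h : ∀ m, DistLE (R m) (1 - δ) (F m) (F' m) ε) :
    DistLE (∑ m, star (M m) * R m * M m) (1 - t * δ) (∑ m, F m ∘ₗ conj (M m))
      (∑ m, F' m ∘ₗ conj (M m)) ((1 - t) * ε + t) := by
  intro K ρ hρ hl
  let e : (X × K) ≃ X × K := Equiv.refl _
  have ht0 := tr_nonneg ρ.2 hρ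
  rcases le_or_gt ε 1 with hε1 | hε1
  swap
  · -- For `ε > 1` the claimed bound is at least one.
    refine (hermLE_sub_tensorId (CP.sum _ fun m _ => (c m).comp (CP.conj _))
      (CP.sum _ fun m _ => (c' m).comp (CP.conj _)) (TNI.sum_comp_conj hM i)
      (TNI.sum_comp_conj hM i') _ hρ).mono ?_
    exact mul_le_mul_of_nonneg_right (by nlinarith) ht0
  have hMe : ∑ m, star (tensorOp e (M m)) * tensorOp e (M m) = 1 := by
    simp_rw [← tensorOp_star, ← tensorOp_mul]
    rw [← tensorOp_sum, hM, tensorOp_one]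
  let r : Fin n → TC (X × K) := fun m => conj (tensorOp e (M m)) ρ
  have hr : ∀ m, 0 ≤ (r m : Op (X × K)) := fun m => coe_conj_nonneg _ hρ
  let p : Fin n → ℝ := fun m => (tr (r m : Op (X × K))).re
  let s : Fin n → ℝ := fun m => (tr (tensorOp e (R m) * (r m : Op (X × K)))).re
  have hp : ∀ m, 0 ≤ p m := fun m => tr_nonneg (r m).2 (hr m)
  have hpsum : ∑ m, p m = (tr (ρ : Op (X × K))).re := sum_tr_conj hMe ρ
  have hsp : ∀ m, s m ≤ p m := fun m =>
    tr_mul_le (by simpa [tensorOp_one] using tensorOp_mono e (hR m)) (hr m)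
  have hssum : ∑ m, s m
      = (tr (tensorOp e (∑ m, star (M m) * R m * M m) * (ρ : Op (X × K)))).re := by
    rw [tensorOp_sum, tr_mul_sum_left, Complex.re_sum]
    refine Finset.sum_congr rfl fun m _ => ?_
    change (tr (tensorOp e (R m) * (conj (tensorOp e (M m)) ρ : Op (X × K)))).re = _
    rw [tr_mul_conj, tensorOp_mul, tensorOp_mul, tensorOp_star]
  have hmark : ∑ m with s m < (1 - δ) * p m, p m ≤ t * (tr (ρ : Op (X × K))).re := by
    rw [← hpsum]
    refine sum_filter_lt_le hsp hδ ht hp ?_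
    rw [hpsum, hssum]
    exact hl
  have hout : ∀ G : Fin n → SuperMap X, (∀ m, CP (G m)) →
      (tensorId e (∑ m, G m ∘ₗ conj (M m)) ρ : Op (X × K))
        = ∑ m, (tensorId e (G m) (r m) : Op (X × K)) := by
    intro G hG
    rw [CP.tensorId_sum _ fun m _ => (hG m).comp (CP.conj _), LinearMap.sum_apply,
      Submodule.coe_sum]
    refine Finset.sum_congr rfl fun m _ => ?_
    rw [(hG m).tensorId_comp (CP.conj _), tensorId_conj]
    rfl
  have hbr : ∀ m, HermLE ((tensorId e (F m) (r m) : Op (X × K)) -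
      (tensorId e (F' m) (r m) : Op (X × K)))
      (2 * (ε * p m + if s m < (1 - δ) * p m then (1 - ε) * p m else 0)) := by
    intro m
    by_cases hm : s m < (1 - δ) * p m
    · rw [if_pos hm]
      exact (hermLE_sub_tensorId (c m) (c' m) (i m) (i' m) e (hr m)).mono (by
        change 2 * p m ≤ _
        linarith)
    · rw [if_neg hm]
      exact (h m K (r m) (hr m) (not_lt.1 hm)).mono (by
        change 2 * ε * p m ≤ _
        linarith)
  change HermLE ((tensorId e _ ρ : Op (X × K)) - (tensorId e _ ρ : Op (X × K))) _
  rw [hout F c, hout F' c', ← Finset.sum_sub_distrib]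
  refine (HermLE.sum Finset.univ fun m _ => hbr m).mono ?_
  rw [← Finset.mul_sum, Finset.sum_add_distrib, ← Finset.mul_sum, hpsum, ← Finset.sum_filter,
    ← Finset.mul_sum]
  have := mul_le_mul_of_nonneg_left hmark (sub_nonneg.2 hε1)
  linarith

/-! ### Bounded loops -/

theorem sum_le_of_geometric {x : ℕ → ℝ} {a c : ℝ} {n : ℕ} (ha : a < 1) (h0 : ∀ j, 0 ≤ x j)
    (hc : ∀ j, x j ≤ c) (h : ∀ j, x (n + j) ≤ a * x j) (k : ℕ) :
    ∑ j ∈ Finset.range k, x j ≤ n * c / (1 - a) := by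
  rw [le_div_iff₀ (by linarith)]
  have h1 : ∑ j ∈ Finset.range k, x j ≤ ∑ j ∈ Finset.range (n + k), x j :=
    Finset.sum_le_sum_of_subset_of_nonneg (Finset.range_mono (Nat.le_add_left k n))
      fun j _ _ => h0 j
  rw [Finset.sum_range_add] at h1
  have h2 : ∑ j ∈ Finset.range n, x j ≤ n * c := by
    simpa using Finset.sum_le_sum fun j (_ : j ∈ Finset.range n) => hc j
  have h3 : ∑ j ∈ Finset.range k, x (n + j) ≤ a * ∑ j ∈ Finset.range k, x j := by
    rw [Finset.mul_sum]
    exact Finset.sum_le_sum fun j _ => h j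
  linarith

/-- The errors of the iterations of a loop add up: in each iteration the error is at most
`ε` times the weight of the part of the ideal state that has not yet left the loop. -/
theorem hermLE_unrolling {Z : Type} {M₀ M₁ R : Op Z} {F F' : SuperMap Z}
    (hM : star M₀ * M₀ + star M₁ * M₁ = 1)
    (hF : ∀ ρ : TC Z, 0 ≤ (ρ : Op Z) → 0 ≤ (F ρ : Op Z)) (hFt : TNI F)
    (hF' : ∀ ρ : TC Z, 0 ≤ (ρ : Op Z) → 0 ≤ (F' ρ : Op Z))
    (hinv : ∀ ρ : TC Z, 0 ≤ (ρ : Op Z) →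
      lam * (tr (ρ : Op Z)).re ≤ (tr (R * (ρ : Op Z))).re →
      lam * (tr (F' (conj M₁ ρ) : Op Z)).re ≤ (tr (R * (F' (conj M₁ ρ) : Op Z))).re ∧
      HermLE ((F (conj M₁ ρ) : Op Z) - (F' (conj M₁ ρ) : Op Z))
        (2 * ε * (tr (conj M₁ ρ : Op Z)).re)) (k : ℕ) {ρ : TC Z} (hρ : 0 ≤ (ρ : Op Z))
    (hl : lam * (tr (ρ : Op Z)).re ≤ (tr (R * (ρ : Op Z))).re) :
    HermLE ((unrolling M₀ M₁ F k ρ : Op Z) - (unrolling M₀ M₁ F' k ρ : Op Z))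
      (2 * ε * ∑ j ∈ Finset.range k,
        (tr (conj M₁ ((F' ∘ₗ conj M₁ : SuperMap Z)^[j] ρ) : Op Z)).re) := by
  induction k generalizing ρ with
  | zero => simpa [unrolling] using HermLE.zero
  | succ k ih =>
    obtain ⟨h1, h2⟩ := hinv ρ hρ hl
    have h3 := ih (hF' _ (coe_conj_nonneg M₁ hρ)) h1
    have h4 := HermLE.map (unrolling M₀ M₁ F k) (fun _ => unrolling_nonneg hF k)
      (TNI.unrolling hM hF hFt k) (T := F (conj M₁ ρ) - F' (conj M₁ ρ)) h2
    have h5 : ∀ F : SuperMap Z, (unrolling M₀ M₁ F (k + 1) ρ : Op Z)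
        = (conj M₀ ρ : Op Z) + (unrolling M₀ M₁ F k (F (conj M₁ ρ)) : Op Z) := fun _ => rfl
    have h6 : (unrolling M₀ M₁ F (k + 1) ρ : Op Z) - (unrolling M₀ M₁ F' (k + 1) ρ : Op Z)
        = (unrolling M₀ M₁ F k (F (conj M₁ ρ) - F' (conj M₁ ρ)) : Op Z)
          + ((unrolling M₀ M₁ F k (F' (conj M₁ ρ)) : Op Z)
            - (unrolling M₀ M₁ F' k (F' (conj M₁ ρ)) : Op Z)) := by
      rw [h5, h5, map_sub, Submodule.coe_sub]
      abel
    rw [h6, Finset.sum_range_succ', mul_add]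
    exact (h4.add h3).mono (add_comm _ _).le

theorem IsDual.iterate {G : SuperMap X} {G' : Op X → Op X} (h : IsDual G G') (n : ℕ) (A : Op X)
    (T : TC X) : tr (A * (G^[n] T : Op X)) = tr (G'^[n] A * (T : Op X)) := by
  induction n generalizing A with
  | zero => rfl
  | succ n ih => rw [Function.iterate_succ_apply', h, ih, Function.iterate_succ_apply]

theorem block_tensorId_iterate {G : SuperMap X} (h : CP G) {K Z : Type} (e : X × K ≃ Z) (n : ℕ)
    (T : TC Z) (k l : K) : block e k l ((tensorId e G)^[n] T) = G^[n] (block e k l T) := by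
  induction n with
  | zero => rfl
  | succ n ih => rw [Function.iterate_succ_apply', h.block_tensorId, ih,
      Function.iterate_succ_apply']

/-- Bounded loops: `(G ^ n)^* (M₁† M₁) ≤ a M₁† M₁` for the ideal iteration `G` makes the weight of
the state entering the body shrink by the factor `a` every `n` iterations. -/
theorem DistLE.loop {M₀ M₁ : Op X} (hM : star M₀ * M₀ + star M₁ * M₁ = 1)
    (c : CP E) (c' : CP E') (i : TNI E) (i' : TNI E') (hlam : 0 ≤ lam) (hε : 0 ≤ ε)
    (h : DistLE Q lam E E' ε)
    (hH : ∀ ρ : TC X, IsPartialDensity ρ → (tr (Q * (ρ : Op X))).re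
      ≤ (tr (((lam : ℂ) • (star M₀ * M₀) + star M₁ * Q * M₁) * (E' ρ : Op X))).re)
    {a : ℝ} {n : ℕ} (ha : a < 1) {G' : Op X → Op X} (hG' : IsDual (E' ∘ₗ conj M₁) G')
    (hb : G'^[n] (star M₁ * M₁) ≤ (a : ℂ) • (star M₁ * M₁)) :
    DistLE ((lam : ℂ) • (star M₀ * M₀) + star M₁ * Q * M₁) lam (supMap (unrolling M₀ M₁ E))
      (supMap (unrolling M₀ M₁ E')) (n * ε / (1 - a)) := by
  intro K ρ hρ hl
  let e : (X × K) ≃ X × K := Equiv.refl _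
  let N₀ := tensorOp e M₀
  let N₁ := tensorOp e M₁
  let F := tensorId e E
  let F' := tensorId e E'
  let R := tensorOp e ((lam : ℂ) • (star M₀ * M₀) + star M₁ * Q * M₁)
  have hN : star N₀ * N₀ + star N₁ * N₁ = 1 := by
    rw [← tensorOp_star, ← tensorOp_star, ← tensorOp_mul, ← tensorOp_mul, ← tensorOp_add, hM,
      tensorOp_one]
  have hR : R = (lam : ℂ) • (star N₀ * N₀) + star N₁ * tensorOp e Q * N₁ := by
    change tensorOp e _ = _
    rw [tensorOp_add, tensorOp_smul, tensorOp_mul, tensorOp_mul, tensorOp_mul, tensorOp_star,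
      tensorOp_star]
  have hF : ∀ ρ : TC (X × K), 0 ≤ (ρ : Op (X × K)) → 0 ≤ (F ρ : Op (X × K)) :=
    fun _ => c.tensorId_nonneg e
  have hF' : ∀ ρ : TC (X × K), 0 ≤ (ρ : Op (X × K)) → 0 ≤ (F' ρ : Op (X × K)) :=
    fun _ => c'.tensorId_nonneg e
  have hFt : TNI F := i.tensorId c e
  have hFt' : TNI F' := i'.tensorId c' e
  -- The loop invariant: the ideal state satisfies `R` to degree `lam` before each iteration.
  have hinv : ∀ σ : TC (X × K), 0 ≤ (σ : Op (X × K)) →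
      lam * (tr (σ : Op (X × K))).re ≤ (tr (R * (σ : Op (X × K)))).re →
      lam * (tr (F' (conj N₁ σ) : Op (X × K))).re
        ≤ (tr (R * (F' (conj N₁ σ) : Op (X × K)))).re ∧
      HermLE ((F (conj N₁ σ) : Op (X × K)) - (F' (conj N₁ σ) : Op (X × K)))
        (2 * ε * (tr (conj N₁ σ : Op (X × K))).re) := by
    intro σ hσ hσl
    have h0 : 0 ≤ (conj N₁ σ : Op (X × K)) := coe_conj_nonneg _ hσ
    have h1 : lam * (tr (conj N₁ σ : Op (X × K))).re
        ≤ (tr (tensorOp e Q * (conj N₁ σ : Op (X × K)))).re := by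
      rw [hR, tr_mul_add_left, Complex.add_re, tr_mul_smul_left, Complex.re_ofReal_mul,
        ← tr_conj, ← tr_mul_conj, ← tr_conj_add_tr_conj hN σ] at hσl
      linarith
    refine ⟨?_, h K _ h0 h1⟩
    exact (mul_le_mul_of_nonneg_left (hFt' _ h0) hlam).trans
      (h1.trans (tr_tensorOp_le c' hH e h0))
  let G := F' ∘ₗ conj N₁
  have hG : tensorId e (E' ∘ₗ conj M₁) = G := by
    rw [c'.tensorId_comp (CP.conj _), tensorId_conj]
  have hG0 : ∀ j, 0 ≤ (G^[j] ρ : Op (X × K)) := by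
    intro j
    induction j with
    | zero => exact hρ
    | succ j ih =>
      rw [Function.iterate_succ_apply']
      exact hF' _ (coe_conj_nonneg _ ih)
  have hGt : ∀ j, (tr (G^[j] ρ : Op (X × K))).re ≤ (tr (ρ : Op (X × K))).re := by
    intro j
    induction j with
    | zero => exact le_rfl
    | succ j ih =>
      rw [Function.iterate_succ_apply']
      have h1 := hFt' _ (coe_conj_nonneg N₁ (hG0 j))
      have h2 := tr_conj_add_tr_conj hN (G^[j] ρ)
      have h3 := tr_nonneg (conj N₀ (G^[j] ρ)).2 (coe_conj_nonneg _ (hG0 j))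
      exact h1.trans (by linarith)
  -- `x j` is the weight of the ideal state that enters the body for the `(j + 1)`-st time.
  let x : ℕ → ℝ := fun j => (tr (conj N₁ (G^[j] ρ) : Op (X × K))).re
  have hx : ∀ j, x j = (tr (tensorOp e (star M₁ * M₁) * (G^[j] ρ : Op (X × K)))).re := by
    intro j
    change (tr (conj N₁ (G^[j] ρ) : Op (X × K))).re = _
    rw [tr_conj, tensorOp_mul, tensorOp_star]
  have hx0 : ∀ j, 0 ≤ x j := fun j => tr_nonneg (conj N₁ (G^[j] ρ)).2 (coe_conj_nonneg _ (hG0 j))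
  have hxc : ∀ j, x j ≤ (tr (ρ : Op (X × K))).re := fun j => by
    have h2 := tr_conj_add_tr_conj hN (G^[j] ρ)
    have h3 := tr_nonneg (conj N₀ (G^[j] ρ)).2 (coe_conj_nonneg _ (hG0 j))
    exact le_trans (by linarith : x j ≤ (tr (G^[j] ρ : Op (X × K))).re) (hGt j)
  -- The dual map is only available without the auxiliary space, so the comparison is blockwise.
  have hxa : ∀ j, x (n + j) ≤ a * x j := by
    intro j
    rw [hx, hx, Function.iterate_add_apply]
    refine hasSum_le (fun k => ?_) (hasSum_re_tr_mul_block e _ _)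
      ((hasSum_re_tr_mul_block e _ _).mul_left a)
    rw [← hG, block_tensorId_iterate (c'.comp (CP.conj M₁)), hG'.iterate, hG]
    refine (tr_mul_mono hb (block_self_nonneg e k (hG0 j))).trans_eq ?_
    rw [tr_mul_smul_left, Complex.re_ofReal_mul]
  have hsum := sum_le_of_geometric ha hx0 hxc hxa
  refine HermLE.wlim (hyperfilter ℕ) (fun k => ?_)
    ((wlim_tensorId (hyperfilter ℕ) c.unrolling (TNI.unrolling hM (fun _ => c.nonneg) i)
      (supMap_unrolling_wlim hM c i) e hρ).sub
    (wlim_tensorId (hyperfilter ℕ) c'.unrolling (TNI.unrolling hM (fun _ => c'.nonneg) i')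
      (supMap_unrolling_wlim hM c' i') e hρ))
  rw [tensorId_unrolling e c, tensorId_unrolling e c']
  refine (hermLE_unrolling hN hF hFt hF' hinv k hρ hl).mono ?_
  refine (mul_le_mul_of_nonneg_left (hsum k) (by positivity : 0 ≤ 2 * ε)).trans_eq ?_
  ring

end Dist

/-! ### Soundness of the rules -/

section Programs
variable {V : Type} [DecidableEq V] {B : V → Type}

theorem conj_predicate_nonneg {X : Type} {Q : Op X} (hQ : 0 ≤ Q) (M : Op X) :
    0 ≤ star M * Q * M := by
  have := conj_nonneg hQ (star M)
  rwa [show adjoint (star M) = M from star_star M] at this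

theorem conj_predicate_le {X : Type} {Q : Op X} (hQ : Q ≤ 1) (M : Op X) :
    star M * Q * M ≤ star M * M := by
  have := conj_predicate_nonneg (sub_nonneg.2 hQ) M
  rwa [mul_sub, sub_mul, mul_one, sub_nonneg] at this

theorem Robust.distLE {zero : ∀ q, B q} {Q : Op (Conf B)} {lam ε : ℝ} {P : NoisyProg B}
    (h : Robust zero Q lam P ε) : DistLE Q lam (P.sem zero) (P.ideal.sem zero) ε :=
  DistLE.of_diamondDist_le (P.sem_cp_tni zero).1 (P.ideal.sem_cp_tni zero).1
    (P.sem_cp_tni zero).2 (P.ideal.sem_cp_tni zero).2 h.nonneg h.dist_le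

theorem Derivable.robust {zero : ∀ q, B q} {Q : Op (Conf B)} {lam ε : ℝ} {P : NoisyProg B}
    (h : Derivable zero Q lam P ε) : Robust zero Q lam P ε := by
  induction h with
  | skip hQ hlam => exact ⟨hQ, hlam, le_rfl, DistLE.self.diamondDist_le⟩
  | initVar q hQ hlam => exact ⟨hQ, hlam, le_rfl, DistLE.self.diamondDist_le⟩
  | @unitary Q lam ε s U p Φ hQ hlam hε h =>
    have hU : TNI (conj (liftOp s U.1) : SuperMap (Conf B)) :=
      TNI.conj_unitary (star_liftOp_unitary U)
    have hΦ : CP (liftMap s Φ.1 : SuperMap (Conf B)) := Φ.2.cp.tensorId _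
    have hΦ' : TNI (liftMap s Φ.1 : SuperMap (Conf B)) := Φ.2.tni.tensorId Φ.2.cp _
    exact ⟨hQ, hlam, mul_nonneg p.2.1 hε, (DistLE.mixture (CP.conj _) hΦ p.2.1 p.2.2
      (DistLE.of_diamondDist_le (CP.conj _) hΦ hU hΦ' hε h)).diamondDist_le⟩
  | weaken hQ hlam _ hε hQQ' hlam' ih =>
    exact ⟨hQ, hlam, ih.nonneg.trans hε, (ih.distLE.mono hε hQQ' hlam').diamondDist_le⟩
  | rescale hδ _ hQ _ hlam _ ih =>
    exact ⟨hQ, hlam, ih.nonneg, (DistLE.rescale hδ ih.distLE).diamondDist_le⟩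
  | @seq Q₁ Q₂ lam ε₁ ε₂ P₁ P₂ _ _ h ih₁ ih₂ =>
    exact ⟨ih₁.predicate, ih₁.degree, add_nonneg ih₁.nonneg ih₂.nonneg,
      (DistLE.comp (P₁.sem_cp_tni zero).1 (P₁.ideal.sem_cp_tni zero).1 (P₂.sem_cp_tni zero).1
        (P₂.ideal.sem_cp_tni zero).1 (P₁.ideal.sem_cp_tni zero).2 (P₂.sem_cp_tni zero).2
        ih₁.degree.1 ih₂.nonneg ih₁.distLE ih₂.distLE h).diamondDist_le⟩
  | @cases s n M P Q t δ ε ht hδ _ ih =>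
    have hM := M.sum_lift (B := B)
    -- A measurement has at least one outcome, because the state space is not zero.
    have hε : 0 ≤ ε := by
      rcases n with _ | n
      · have h1 : (0 : Op (Conf B)) = 1 := by simpa using hM
        have h2 := congrArg (fun A : Op (Conf B) => ‖A (ket zero)‖) h1
        simp [norm_ket] at h2
      · exact (ih 0).nonneg
    refine ⟨⟨Finset.sum_nonneg fun m _ => conj_predicate_nonneg (ih m).predicate.1 _, ?_⟩,
      ⟨by nlinarith [ht.1, ht.2, hδ.1, hδ.2], by nlinarith [ht.1, ht.2, hδ.1, hδ.2]⟩,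
      add_nonneg (mul_nonneg (sub_nonneg.2 ht.2) hε) ht.1, ?_⟩
    · rw [← hM]
      exact Finset.sum_le_sum fun m _ => conj_predicate_le (ih m).predicate.2 _
    · exact (DistLE.measure hM ht.1 ht.2 hδ.1 (fun m => (ih m).predicate.2)
        (fun m => ((P m).sem_cp_tni zero).1) (fun m => ((P m).ideal.sem_cp_tni zero).1)
        (fun m => ((P m).sem_cp_tni zero).2) (fun m => ((P m).ideal.sem_cp_tni zero).2)
        fun m => (ih m).distLE).diamondDist_le
  | @whileBounded s M P Q lam ε a n _ hH hb ih =>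
    obtain ⟨ha0, ha1, -, G', hG', hle⟩ := hb
    refine ⟨⟨add_nonneg (smul_op_nonneg (star_mul_self_nonneg _) ih.degree.1)
      (conj_predicate_nonneg ih.predicate.1 _), ?_⟩, ih.degree,
      div_nonneg (mul_nonneg n.cast_nonneg ih.nonneg) (sub_nonneg.2 ha1.le), ?_⟩
    · rw [← M.lift_add]
      refine add_le_add ?_ (conj_predicate_le ih.predicate.2 _)
      have h1 := smul_op_nonneg (star_mul_self_nonneg (M.lift (B := B) 0))
        (sub_nonneg.2 ih.degree.2)
      rwa [Complex.ofReal_sub, Complex.ofReal_one, sub_smul, one_smul, sub_nonneg] at h1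
    · exact (DistLE.loop M.lift_add (P.sem_cp_tni zero).1 (P.ideal.sem_cp_tni zero).1
        (P.sem_cp_tni zero).2 (P.ideal.sem_cp_tni zero).2 ih.degree.1 ih.nonneg ih.distLE hH ha1
        hG' hle).diamondDist_le
  | @whileUnbounded s M P Q lam hQ hlam =>
    refine ⟨hQ, hlam, zero_le_one, DistLE.diamondDist_le fun K ρ hρ _ => ?_⟩
    have h1 := (NoisyProg.loop s M P).sem_cp_tni zero
    have h2 := (NoisyProg.loop s M P).ideal.sem_cp_tni zero
    rw [mul_one]
    exact hermLE_sub_tensorId h1.1 h2.1 h1.2 h2.2 _ hρ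

end Programs

end QRobust

end

theorem mainTheorem1 {V : Type} [Fintype V] [DecidableEq V] {B : V → Type} (zero : ∀ q, B q)
    (Q : QRobust.Op (∀ q, B q)) (lam ε : ℝ) (P : QRobust.NoisyProg B)
    (h : QRobust.Derivable zero Q lam P ε) : QRobust.Robust zero Q lam P ε :=
  h.robust
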